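/- Let $D>1$ be a square-free integer, $K=\mathbb{Q}(\sqrt D)\subset\mathbb{R}$, with conjugation $a\mapsto\bar a$, ring of integers $\mathcal{O}_K$, and fundamental unit $\varepsilon>1$. Put $\alpha_K=\frac{1+\sqrt D}{2}$ if $D\equiv 1\pmod 4$ and $\alpha_K=\sqrt D$ otherwise. Identify $V_K=K\otimes_{\mathbb{Q}}\mathbb{R}$ with $\mathbb{R}\times\mathbb{R}$ through $a\otimes 1\mapsto(\bar a,a)$, so that $\mathcal{O}_K$ is a lattice in $V_K$, and let $\mathbb{T}_K=V_K/\mathcal{O}_K$. Let $\mathbf{N}(s,u)=|su|$, let $\phi$ be the automorphism of $\mathbb{T}_K$ induced by multiplication by $\varepsilon$, that is by $(s,u)\mapsto(\bar\varepsilon s,\varepsilon u)$, let $M(P)=\inf_{Q\in\mathcal{O}_K}\mathbf{N}(P-Q)$, a function on $\mathbb{T}_K$, and let $X_t=\{P\in\mathbb{T}_K : M(P)\ge t\}$. Let $R_0=(0,-\overline{\alpha_K})\times(0,1)$ and $R_1=(-1,0)\times(0,\alpha_K)$ in the coordinates $(s,u)$; these open rectangles project injectively to $\mathbb{T}_K$.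 Let $\mathcal{P}_0=\{R_0,R_1\}$ if $D=5$, and otherwise let $\mathcal{P}_0$ be the set of connected components of the sets $A\cap\phi^{-1}(B)$ with $A,B\in\{R_0,R_1\}$. This is a Markov generator for $\phi$. Let $\Sigma\subseteq\mathcal{P}_0^{\mathbb{Z}}$ be the set of strings $s$ with $s_i\cap\phi^{-1}(s_{i+1})\ne\emptyset$ for all $i\in\mathbb{Z}$, and let $\pi:\Sigma\to\mathbb{T}_K$ be the coding map, for which $\pi(s)$ is the unique point of $\bigcap_{n}\overline{\bigcap_{i=-n}^{n}\phi^{-i}(s_i)}$. For $n\ge 0$ let $\mathcal{P}_n$ be the set of nonempty intersections $\phi^{n}(A_{-n})\cap\cdots\cap A_0\cap\cdots\cap\phi^{-n}(A_n)$ with $A_i\in\mathcal{P}_0$; such an intersection has the coordinate word $A_{-n}\cdots A_0\cdots A_n$, and is represented in $V_K$ by the part of $R_0\cup R_1$ that lies over it. For a set $\mathcal{C}\subseteq\bigcup_n\mathcal{P}_n$ let $\Sigma\langle\mathcal{C}\rangle$ be the set of $s\in\Sigma$ in which no coordinate word of a member of $\mathcal{C}$ occurs. For a finite set $I\subseteq\mathcal{O}_K$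 let $\mathcal{U}(t,I)=\bigcup_{Q\in I}\{P\in V_K : \mathbf{N}(P-Q)<t\}$, and let $\mathcal{T}_n(t,I)$ be the set of those $A\in\mathcal{P}_n$ for which the closure in $V_K$ of the representative of $A$ is contained in $\mathcal{U}(t,I)$. There is a finite set $I_K\subseteq\mathcal{O}_K$ such that for every finite set $I$ with $I_K\subseteq I\subseteq\mathcal{O}_K$ the following holds. If $t>0$ and $X_t=X_{t-\eta}$ for some $\eta>0$, then $\pi^{-1}(X_t)$ is a subshift of finite type over the finite alphabet $\mathcal{P}_0$ (the set of all strings in $\mathcal{P}_0^{\mathbb{Z}}$ in which none of finitely many forbidden words occurs), and $\pi^{-1}(X_t)=\Sigma\langle\mathcal{T}_n(t,I)\rangle$ for some $n\in\mathbb{N}$. -/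

import Mathlib

open Set Topology

noncomputable section

namespace QuadTorus

/-! ### The real quadratic field, its integers, and the torus -/

/-- `K = ℚ(√D)`, as `ℚ[ω]` with `ω ^ 2 = D`; Galois conjugation is `star`. -/
abbrev K (D : ℕ) : Type := QuadraticAlgebra ℚ (D : ℚ) 0

/-- The ring of integers of `K`: the integral closure of `ℤ` in `K`. -/
abbrev O (D : ℕ) : Subalgebra ℤ (K D) := integralClosure ℤ (K D)

/-- The embedding of `K` in `ℝ` that sends `ω` to the positive square root of `D`. -/
def realEmb (D : ℕ) : K D →ₐ[ℚ] ℝ :=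
  QuadraticAlgebra.lift ⟨√(D : ℝ), by
    rw [Real.mul_self_sqrt (Nat.cast_nonneg D)]; simp [Algebra.smul_def]⟩

/-- The embedding `a ↦ (ā, a)` of `K` in `V_K = K ⊗ ℝ ≅ ℝ × ℝ`, in stable and unstable
coordinates `(s, u)`. -/
def embed (D : ℕ) : K D →+* ℝ × ℝ :=
  ((realEmb D).toRingHom.comp (starRingEnd (K D))).prod (realEmb D).toRingHom

/-- The ring of integers as a lattice in `V_K`. -/
def lattice (D : ℕ) : AddSubgroup (ℝ × ℝ) :=
  (O D).toSubring.toAddSubgroup.map (embed D).toAddMonoidHom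

/-- The torus `𝕋_K = V_K / O_K`. -/
abbrev Torus (D : ℕ) : Type := (ℝ × ℝ) ⧸ lattice D

/-- The projection `V_K → 𝕋_K`. -/
def proj (D : ℕ) (v : ℝ × ℝ) : Torus D := QuotientAddGroup.mk v

/-- The extension of the absolute norm to `V_K`. -/
def absNorm (v : ℝ × ℝ) : ℝ := |v.1 * v.2|

/-- `absNorm` restricts to the absolute norm of the field. -/
theorem absNorm_embed (D : ℕ) (a : K D) :
    absNorm (embed D a) = |((QuadraticAlgebra.norm a : ℚ) : ℝ)| := by
  have h : realEmb D (algebraMap ℚ (K D) (QuadraticAlgebra.norm a)) =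
      realEmb D (star a) * realEmb D a := by
    rw [← map_mul, mul_comm, QuadraticAlgebra.algebraMap_norm_eq_mul_star]
  rw [AlgHom.commutes] at h
  exact congrArg abs h.symm

/-- `M(P) = inf_{Q ∈ O_K} N(P - Q)` on `V_K`. -/
def euclMinV (D : ℕ) (v : ℝ × ℝ) : ℝ := ⨅ q : lattice D, absNorm (v - q)

theorem euclMinV_sub (D : ℕ) (v : ℝ × ℝ) (r : lattice D) :
    euclMinV D (v - r) = euclMinV D v := by
  unfold euclMinV
  refine Equiv.iInf_congr (Equiv.addLeft r) fun q => ?_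
  simp [sub_sub]

/-- The function `M` on the torus. -/
def euclMin (D : ℕ) (P : Torus D) : ℝ :=
  Quotient.liftOn' P (euclMinV D) fun a b h => by
    have h' : -a + b ∈ lattice D := QuotientAddGroup.leftRel_apply.mp h
    have := euclMinV_sub D b ⟨-a + b, h'⟩
    simpa using this

/-- `X_t`, the set of points of the torus with `M(P) ≥ t`. -/
def X (D : ℕ) (t : ℝ) : Set (Torus D) := {P | t ≤ euclMin D P}

/-! ### The dynamical system -/

/-- `ε` is the fundamental unit with `ε > 1`. -/
def IsFundamentalUnit (D : ℕ) (ε : (O D)ˣ) : Prop :=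
  1 < realEmb D (ε : O D) ∧ ∀ u : (O D)ˣ, ∃ k : ℤ, u = ε ^ k ∨ u = -ε ^ k

/-- `ε` as a unit of the ring `ℝ × ℝ`, that is `(ε̄, ε)`. -/
def unitV (D : ℕ) (ε : (O D)ˣ) : (ℝ × ℝ)ˣ :=
  Units.map ((embed D).comp (O D).subtype).toMonoidHom ε

/-- `φ` on `V_K`: multiplication by `ε`. -/
def phiV (D : ℕ) (ε : (O D)ˣ) : (ℝ × ℝ) ≃+ (ℝ × ℝ) :=
  { (unitV D ε).mulLeft with map_add' := fun v w => mul_add (unitV D ε : ℝ × ℝ) v w }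

theorem phiV_embed (D : ℕ) (ε : (O D)ˣ) (a : K D) :
    phiV D ε (embed D a) = embed D ((ε : O D) * a) := (map_mul (embed D) _ _).symm

theorem map_phiV (D : ℕ) (ε : (O D)ˣ) :
    (lattice D).map (phiV D ε).toAddMonoidHom = lattice D := by
  ext v
  constructor
  · rintro ⟨_, ⟨a, ha, rfl⟩, rfl⟩
    exact ⟨_, (O D).mul_mem (ε : O D).2 ha, (phiV_embed D ε a).symm⟩
  · rintro ⟨a, ha, rfl⟩
    refine ⟨_, ⟨(ε⁻¹ : (O D)ˣ) * a, (O D).mul_mem ((ε⁻¹ : (O D)ˣ) : O D).2 ha, rfl⟩, ?_⟩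
    refine (phiV_embed D ε _).trans ?_
    have h : ((ε : O D) : K D) * (((ε⁻¹ : (O D)ˣ) : O D) : K D) = 1 := by
      exact_mod_cast congrArg (Subtype.val) (Units.mul_inv ε)
    rw [← mul_assoc, h, one_mul]
    rfl

/-- `φ` on the torus. -/
def phi (D : ℕ) (ε : (O D)ˣ) : Equiv.Perm (Torus D) :=
  (QuotientAddGroup.congr (lattice D) (lattice D) (phiV D ε) (map_phiV D ε)).toEquiv

/-! ### The Markov generator -/

/-- `α_K`, the second element of the standard integral basis `1, α_K`. -/
def alphaK (D : ℕ) : K D := if D % 4 = 1 then ⟨1 / 2, 1 / 2⟩ else ⟨0, 1⟩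

/-- `α_K` as a real number. -/
def al (D : ℕ) : ℝ := realEmb D (alphaK D)

/-- The conjugate of `α_K` as a real number. -/
def alBar (D : ℕ) : ℝ := realEmb D (star (alphaK D))

/-- The open rectangle with corners `(0, 0)` and `(-ᾱ_K, 1)` in `(s, u)`-coordinates. -/
def R0 (D : ℕ) : Set (ℝ × ℝ) := Ioo 0 (-alBar D) ×ˢ Ioo 0 1

/-- The open rectangle with corners `(-1, 0)` and `(0, α_K)` in `(s, u)`-coordinates. -/
def R1 (D : ℕ) : Set (ℝ × ℝ) := Ioo (-1) 0 ×ˢ Ioo 0 (al D)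

/-- The part of the planar set `A` lying over `φ⁻¹(B)`. -/
def overlap (D : ℕ) (ε : (O D)ˣ) (A B : Set (ℝ × ℝ)) : Set (ℝ × ℝ) :=
  {v ∈ A | phi D ε (proj D v) ∈ proj D '' B}

/-- The Markov generator `𝒫₀`. Its members are listed by their planar representatives inside
`R₀ ∪ R₁`, on which `proj` is injective and open. For `D = 5` it is `{R₀, R₁}`; otherwise it
consists of the connected components of the sets `A ∩ φ⁻¹(B)`, with `A, B ∈ {R₀, R₁}`. -/
def P0 (D : ℕ) (ε : (O D)ˣ) : Set (Set (ℝ × ℝ)) :=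
  if D = 5 then {R0 D, R1 D}
  else {C | ∃ A ∈ ({R0 D, R1 D} : Set (Set (ℝ × ℝ))),
    ∃ B ∈ ({R0 D, R1 D} : Set (Set (ℝ × ℝ))),
    ∃ v ∈ overlap D ε A B, C = connectedComponentIn (overlap D ε A B) v}

/-- The alphabet of the symbolic coding. -/
abbrev Letter (D : ℕ) (ε : (O D)ˣ) : Type := ↥(P0 D ε)

/-- The member of the partition of the torus named by a letter. -/
def tset (D : ℕ) (ε : (O D)ˣ) (A : Letter D ε) : Set (Torus D) := proj D '' (A : Set (ℝ × ℝ))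

/-! ### Symbolic coding -/

/-- `Σ`, the bi-infinite strings all of whose transitions `A B` are admissible, that is
`A ∩ φ⁻¹(B) ≠ ∅`. -/
def Sig (D : ℕ) (ε : (O D)ˣ) : Set (ℤ → Letter D ε) :=
  {s | ∀ i : ℤ, (tset D ε (s i) ∩ phi D ε ⁻¹' tset D ε (s (i + 1))).Nonempty}

/-- `⋂ₙ closure (⋂_{|i| ≤ n} φ⁻ⁱ(s_i))`. -/
def codingSet (D : ℕ) (ε : (O D)ˣ) (s : ℤ → Letter D ε) : Set (Torus D) :=
  ⋂ n : ℕ, closure (⋂ i ∈ Icc (-(n : ℤ)) n, {P | (phi D ε ^ i) P ∈ tset D ε (s i)})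

/-- The coding map: `π(s)` is the point `P` with `codingSet s = {P}`. -/
def piMap (D : ℕ) (ε : (O D)ˣ) (s : ℤ → Letter D ε) : Torus D :=
  Classical.epsilon fun P => codingSet D ε s = {P}

/-- `π⁻¹(Y)`, a subset of `Σ`. -/
def piInv (D : ℕ) (ε : (O D)ˣ) (Y : Set (Torus D)) : Set (ℤ → Letter D ε) :=
  {s ∈ Sig D ε | piMap D ε s ∈ Y}

/-- Words `A₋ₙ ⋯ A₀ ⋯ Aₙ`. -/
abbrev Word (D : ℕ) (ε : (O D)ˣ) (n : ℕ) : Type := Icc (-(n : ℤ)) n → Letter D ε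

/-- The planar representative, inside `R₀ ∪ R₁`, of
`φⁿ(A₋ₙ) ∩ ⋯ ∩ A₀ ∩ ⋯ ∩ φ⁻ⁿ(Aₙ)`. -/
def cell (D : ℕ) (ε : (O D)ˣ) (n : ℕ) (w : Word D ε n) : Set (ℝ × ℝ) :=
  {v ∈ (w ⟨0, by simp⟩ : Set (ℝ × ℝ)) | ∀ i : Icc (-(n : ℤ)) n, (phi D ε ^ (i : ℤ)) (proj D v) ∈ tset D ε (w i)}

/-- The refinement `𝒫ₙ`: the nonempty cells at level `n`. -/
def Pn (D : ℕ) (ε : (O D)ˣ) (n : ℕ) : Set (Set (ℝ × ℝ)) :=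
  {A | A.Nonempty ∧ ∃ w : Word D ε n, A = cell D ε n w}

/-- `Σ⟨𝒞⟩`: the strings in `Σ` in which no coordinate word of a member of `𝒞` occurs. -/
def avoid (D : ℕ) (ε : (O D)ˣ) (C : Set (Set (ℝ × ℝ))) : Set (ℤ → Letter D ε) :=
  {s ∈ Sig D ε | ∀ (n : ℕ) (w : Word D ε n), cell D ε n w ∈ C →
    ¬ ∃ k : ℤ, ∀ i : Icc (-(n : ℤ)) n, s (k + (i : ℤ)) = w i}

/-- `𝒰(t, I)`, the points of `V_K` at norm-distance less than `t` from a member of `I`. -/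
def U (D : ℕ) (t : ℝ) (I : Finset (O D)) : Set (ℝ × ℝ) :=
  {v | ∃ q ∈ I, absNorm (v - embed D q) < t}

/-- `𝒯ₙ(t, I)`, the members of `𝒫ₙ` with closure contained in `𝒰(t, I)`. -/
def Tn (D : ℕ) (ε : (O D)ˣ) (n : ℕ) (t : ℝ) (I : Finset (O D)) : Set (Set (ℝ × ℝ)) :=
  {A ∈ Pn D ε n | closure A ⊆ U D t I}

/-- A subshift of finite type over the finite alphabet `α`: the set of all bi-infinite strings
in which none of the words of a finite list of forbidden words occurs. -/
def IsSFT {α : Type*} (Y : Set (ℤ → α)) : Prop :=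
  Finite α ∧ ∃ F : Set (List α), F.Finite ∧
    Y = {s | ∀ w ∈ F, ¬ ∃ k : ℤ, ∀ j : Fin w.length, s (k + (j : ℕ)) = w.get j}

end QuadTorus

end

open Set Topology

noncomputable section

namespace QuadTorus

/-! The function M is invariant under φ, and shifting a string applies a power of φ to the coded
point. If a window of s around k spells a word whose closed cell lies in U(t, I), then a lift of the
coded point of the shifted string lies in that closed cell, so M < t there and hence at π(s). This
gives `piInv_subset_avoid`, for every n and I.

Conversely, suppose π(s) is not in X_t = X_{t-η}. Some lattice translate of a lift of π(s) has norm
below t - η, and also below α² + 1, since lifts in the rectangles are bounded by α. Units preserve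
the norm, so a power of ε moves this translate into a ball of fixed radius
(`exists_norm_phiV_zpow_le`). After the corresponding shift, the lattice point involved is bounded
independently of s, t and η; these bounded lattice points form I_K. Cells of level n have diameter
at most 2α ε⁻ⁿ (`dist_le_of_mem_cell`), and the norm varies by less than the margin η across such a
cell once n is large, so the whole closed cell lies in U(t, I) (`exists_closure_cell_subset_U`).

The coding rests on the Markov property of the two rectangles (`markov_stable`, `markov_unstable`):
pairwise admissible transitions already make every finite cell nonempty. Finite type follows because
membership is decided by windows of bounded length. -/

/-! ### The integral basis 1, α_K and the lattice in coordinates -/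

theorem realEmb_mk (D : ℕ) (x y : ℚ) : realEmb D ⟨x, y⟩ = x + y * √(D : ℝ) := by
  simp [realEmb, QuadraticAlgebra.lift, Algebra.smul_def]

theorem embed_mk (D : ℕ) (x y : ℚ) :
    embed D ⟨x, y⟩ = (x - y * √(D : ℝ), x + y * √(D : ℝ)) := by
  have h : embed D ⟨x, y⟩ = (realEmb D (star ⟨x, y⟩), realEmb D ⟨x, y⟩) := rfl
  rw [h, QuadraticAlgebra.star_mk, realEmb_mk, realEmb_mk]
  simp [sub_eq_add_neg]

theorem isIntegral_star {D : ℕ} {a : K D} (ha : IsIntegral ℤ a) : IsIntegral ℤ (star a) :=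
  ha.map ((starRingEnd (K D)).toIntAlgHom)

theorem exists_int_of_isIntegral_algebraMap {D : ℕ} {x : ℚ}
    (h : IsIntegral ℤ (algebraMap ℚ (K D) x)) : ∃ m : ℤ, (m : ℚ) = x :=
  IsIntegrallyClosed.isIntegral_iff.mp
    ((isIntegral_algebraMap_iff (algebraMap ℚ (K D)).injective).mp h)

/-- Dz is a rational square root of the integer Dc, hence an integer; D divides its square, hence
divides it because D is squarefree. -/
theorem exists_int_of_mul_sq {D : ℕ} (hsq : Squarefree D) {z : ℚ} {c : ℤ}
    (h : (D : ℚ) * z ^ 2 = c) : ∃ n : ℤ, (n : ℚ) = z := by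
  have hD0 : (D : ℚ) ≠ 0 := by exact_mod_cast hsq.ne_zero
  obtain ⟨k, hk⟩ : ∃ k : ℤ, (k : ℚ) = D * z := by
    refine IsIntegrallyClosed.isIntegral_iff.mp (IsIntegral.of_pow (n := 2) two_pos ?_)
    have : ((D : ℚ) * z) ^ 2 = algebraMap ℤ ℚ (D * c) := by
      simp only [eq_intCast]; push_cast; rw [← h]; ring
    rw [this]
    exact isIntegral_algebraMap
  have hkk : k ^ 2 = D * c := by
    have : (k : ℚ) ^ 2 = D * c := by rw [hk, ← h]; ring
    exact_mod_cast this
  have hsq' : Squarefree (D : ℤ) := Int.squarefree_natCast.mpr hsq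
  have : (D : ℤ) ∣ k :=
    (hsq'.dvd_pow_iff_dvd two_ne_zero).mp ⟨c, hkk⟩
  obtain ⟨n, rfl⟩ := this
  refine ⟨n, ?_⟩
  push_cast at hk
  exact mul_left_cancel₀ hD0 hk

/-- Integrality of the trace and norm makes A = 2 re a and C = 2 im a integers with A² - DC²
divisible by 4. Squares modulo 4 then force A ≡ C (mod 2) when D ≡ 1, and both even when D ≡ 2 or 3.
-/
theorem exists_int_of_mem_O {D : ℕ} (hsq : Squarefree D) {a : K D} (ha : a ∈ O D) :
    ∃ m n : ℤ, a = m + n * alphaK D := by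
  have hi : IsIntegral ℤ a := ha
  obtain ⟨A, hA⟩ : ∃ A : ℤ, (A : ℚ) = 2 * a.re := by
    refine exists_int_of_isIntegral_algebraMap (D := D) ?_
    have h := QuadraticAlgebra.algebraMap_trace_eq_add_star (z := a)
    rw [QuadraticAlgebra.trace_def, zero_mul, add_zero] at h
    rw [h]
    exact hi.add (isIntegral_star hi)
  obtain ⟨B, hB⟩ : ∃ B : ℤ, (B : ℚ) = a.norm := by
    refine exists_int_of_isIntegral_algebraMap (D := D) ?_
    rw [QuadraticAlgebra.algebraMap_norm_eq_mul_star]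
    exact hi.mul (isIntegral_star hi)
  have hB' : (B : ℚ) = a.re ^ 2 - D * a.im ^ 2 := by
    rw [hB, QuadraticAlgebra.norm_def]; ring
  obtain ⟨C, hC⟩ : ∃ C : ℤ, (C : ℚ) = 2 * a.im := by
    refine exists_int_of_mul_sq hsq (c := A ^ 2 - 4 * B) ?_
    push_cast; rw [hA, hB']; ring
  have key : A ^ 2 - D * C ^ 2 = 4 * B := by
    have : (A : ℚ) ^ 2 - D * C ^ 2 = 4 * B := by rw [hA, hB', hC]; ring
    exact_mod_cast this
  have hA' : a.re = A / 2 := by rw [hA]; ring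
  have hC' : a.im = C / 2 := by rw [hC]; ring
  have hD4 : D % 4 ≠ 0 := fun h => by
    have : 2 * 2 ∣ D := Nat.dvd_of_mod_eq_zero h
    exact absurd (hsq 2 this) (by simp)
  have hm : (A ^ 2 - (D % 4) * C ^ 2) % 4 = 0 := by
    have h1 : (D : ℤ) = 4 * (D / 4) + D % 4 := (Int.mul_ediv_add_emod _ _).symm
    have h2 : A ^ 2 - (D % 4) * C ^ 2 = 4 * (B + (D / 4) * C ^ 2) := by
      linear_combination key + C ^ 2 * h1
    omega
  have hAm : A % 4 = 0 ∨ A % 4 = 1 ∨ A % 4 = 2 ∨ A % 4 = 3 := by omega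
  have hCm : C % 4 = 0 ∨ C % 4 = 1 ∨ C % 4 = 2 ∨ C % 4 = 3 := by omega
  unfold alphaK
  split_ifs with h
  · have hD1 : (D : ℤ) % 4 = 1 := by omega
    have hpar : (A - C) % 2 = 0 := by
      rw [hD1] at hm
      rcases hAm with h1 | h1 | h1 | h1 <;> rcases hCm with h2 | h2 | h2 | h2 <;>
        simp [pow_two, Int.sub_emod, Int.mul_emod, h1, h2] at hm <;> omega
    obtain ⟨m, hm'⟩ : ∃ m, A = 2 * m + C := ⟨(A - C) / 2, by omega⟩
    refine ⟨m, C, ?_⟩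
    ext
    · simp [hA', hm']; ring
    · simp [hC']; ring
  · have hpar : A % 2 = 0 ∧ C % 2 = 0 := by
      have hD2 : (D : ℤ) % 4 = 2 ∨ (D : ℤ) % 4 = 3 := by omega
      rcases hD2 with h0 | h0 <;> rw [h0] at hm <;>
      rcases hAm with h1 | h1 | h1 | h1 <;> rcases hCm with h2 | h2 | h2 | h2 <;>
        simp [pow_two, Int.sub_emod, Int.mul_emod, h1, h2] at hm <;> omega
    obtain ⟨m, hm'⟩ : ∃ m, A = 2 * m := ⟨A / 2, by omega⟩
    obtain ⟨n, hn'⟩ : ∃ n, C = 2 * n := ⟨C / 2, by omega⟩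
    refine ⟨m, n, ?_⟩
    ext
    · simp [hA', hm']
    · simp [hC', hn']

theorem alphaK_mem (D : ℕ) : alphaK D ∈ O D := by
  show IsIntegral ℤ (alphaK D)
  unfold alphaK
  split_ifs with h
  · obtain ⟨k, hk⟩ : ∃ k : ℕ, D = 4 * k + 1 := ⟨D / 4, by omega⟩
    refine ⟨Polynomial.X ^ 2 - (Polynomial.X + Polynomial.C (k : ℤ)), ?_, ?_⟩
    · apply Polynomial.monic_X_pow_sub
      exact (Polynomial.degree_X_add_C (k : ℤ)).trans_lt (by exact_mod_cast one_lt_two)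
    · rw [← Polynomial.aeval_def]
      simp only [map_sub, map_add, map_pow, Polynomial.aeval_X, Polynomial.aeval_C]
      ext
      · simp [pow_two, hk]; ring
      · simp [pow_two]; ring
  · refine ⟨Polynomial.X ^ 2 - Polynomial.C (D : ℤ), ?_, ?_⟩
    · exact Polynomial.monic_X_pow_sub_C _ two_ne_zero
    · rw [← Polynomial.aeval_def]
      simp only [map_sub, map_pow, Polynomial.aeval_X, Polynomial.aeval_C]
      ext
      · simp [pow_two]
      · simp [pow_two]

theorem embed_alphaK (D : ℕ) : embed D (alphaK D) = (alBar D, al D) := rfl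

theorem embed_int_combo (D : ℕ) (m n : ℤ) :
    embed D (m + n * alphaK D) = (m + n * alBar D, m + n * al D) := by
  rw [map_add, map_mul, embed_alphaK]
  ext <;> simp

theorem mem_lattice {D : ℕ} (hsq : Squarefree D) {v : ℝ × ℝ} :
    v ∈ lattice D ↔ ∃ m n : ℤ, v = (m + n * alBar D, m + n * al D) := by
  constructor
  · rintro ⟨a, ha, rfl⟩
    obtain ⟨m, n, rfl⟩ := exists_int_of_mem_O hsq ha
    exact ⟨m, n, embed_int_combo D m n⟩
  · rintro ⟨m, n, rfl⟩
    exact ⟨m + n * alphaK D, (O D).add_mem ((O D).intCast_mem m)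
      ((O D).mul_mem ((O D).intCast_mem n) (alphaK_mem D)), embed_int_combo D m n⟩

theorem embed_mem_lattice {D : ℕ} (q : O D) : embed D q ∈ lattice D := ⟨q, q.2, rfl⟩

theorem exists_embed_eq {D : ℕ} {v : ℝ × ℝ} (h : v ∈ lattice D) : ∃ q : O D, embed D q = v := by
  obtain ⟨a, ha, rfl⟩ := h
  exact ⟨⟨a, ha⟩, rfl⟩

theorem one_mem_lattice (D : ℕ) : ((1, 1) : ℝ × ℝ) ∈ lattice D := by
  have := embed_mem_lattice (1 : O D)
  rwa [OneMemClass.coe_one, map_one] at this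

theorem al_mem_lattice (D : ℕ) : (alBar D, al D) ∈ lattice D :=
  embed_mem_lattice ⟨alphaK D, alphaK_mem D⟩

/-! ### Size of `α_K` -/

/-- The last two inequalities keep the stable boundary segment invariant under φ when ε̄ < 0. -/
theorem al_bounds {D : ℕ} (hD : 1 < D) :
    1 < al D ∧ alBar D < 0 ∧ 1 ≤ al D * (-alBar D) ∧ -alBar D ≤ al D := by
  have hr : (√(D : ℝ)) ^ 2 = D := Real.sq_sqrt (Nat.cast_nonneg D)
  have h0 : 0 ≤ √(D : ℝ) := Real.sqrt_nonneg _
  have h := embed_alphaK D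
  unfold alphaK at h
  split_ifs at h with h4
  · have hD5 : (5 : ℝ) ≤ D := by
      have : 5 ≤ D := by omega
      exact_mod_cast this
    rw [embed_mk, Prod.mk.injEq] at h
    rw [← h.1, ← h.2]
    push_cast
    refine ⟨?_, ?_, ?_, ?_⟩ <;> nlinarith
  · have hD2 : (2 : ℝ) ≤ D := by exact_mod_cast hD
    rw [embed_mk, Prod.mk.injEq] at h
    rw [← h.1, ← h.2]
    push_cast
    refine ⟨?_, ?_, ?_, ?_⟩ <;> nlinarith

theorem al_five : al 5 ^ 2 = al 5 + 1 ∧ alBar 5 = 1 - al 5 ∧ al 5 * alBar 5 = -1 := by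
  have hr : (√((5 : ℕ) : ℝ)) ^ 2 = (5 : ℕ) := Real.sq_sqrt (Nat.cast_nonneg 5)
  have h := embed_alphaK 5
  rw [alphaK, if_pos (by norm_num), embed_mk, Prod.mk.injEq] at h
  rw [← h.1, ← h.2]
  push_cast at hr ⊢
  refine ⟨?_, ?_, ?_⟩ <;> linarith

/-! ### The two rectangles -/

/-- The stable side of the rectangle `R₀` (`b = false`) or `R₁` (`b = true`). -/
def tileS (D : ℕ) (b : Bool) : Set ℝ := if b then Ioo (-1) 0 else Ioo 0 (-alBar D)

/-- The unstable side of the rectangle `R₀` (`b = false`) or `R₁` (`b = true`). -/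
def tileU (D : ℕ) (b : Bool) : Set ℝ := if b then Ioo 0 (al D) else Ioo 0 1

/-- The rectangles `R₀` (`b = false`) and `R₁` (`b = true`). -/
def tile (D : ℕ) (b : Bool) : Set (ℝ × ℝ) := tileS D b ×ˢ tileU D b

theorem tile_false (D : ℕ) : tile D false = R0 D := rfl

theorem tile_true (D : ℕ) : tile D true = R1 D := rfl

theorem mem_tiles_iff {D : ℕ} {A : Set (ℝ × ℝ)} :
    A ∈ ({R0 D, R1 D} : Set (Set (ℝ × ℝ))) ↔ ∃ b, A = tile D b := by
  simp [Bool.exists_bool, tile_false, tile_true]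

theorem ordConnected_tileS (D : ℕ) (b : Bool) : (tileS D b).OrdConnected := by
  cases b <;> exact ordConnected_Ioo

theorem ordConnected_tileU (D : ℕ) (b : Bool) : (tileU D b).OrdConnected := by
  cases b <;> exact ordConnected_Ioo

theorem isOpen_tile (D : ℕ) (b : Bool) : IsOpen (tile D b) := by
  cases b <;> exact isOpen_Ioo.prod isOpen_Ioo

theorem convex_tile (D : ℕ) (b : Bool) : Convex ℝ (tile D b) := by
  cases b <;> exact (convex_Ioo _ _).prod (convex_Ioo _ _)

theorem tileS_nonempty {D : ℕ} (hD : 1 < D) (b : Bool) : (tileS D b).Nonempty := by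
  obtain ⟨-, hb, -⟩ := al_bounds hD
  cases b
  · exact nonempty_Ioo.mpr (by linarith)
  · exact nonempty_Ioo.mpr (by norm_num)

theorem tileU_nonempty {D : ℕ} (hD : 1 < D) (b : Bool) : (tileU D b).Nonempty := by
  obtain ⟨ha, -⟩ := al_bounds hD
  cases b
  · exact nonempty_Ioo.mpr (by norm_num)
  · exact nonempty_Ioo.mpr (by linarith)

theorem norm_le_of_mem_tile {D : ℕ} (hD : 1 < D) {b : Bool} {v : ℝ × ℝ} (hv : v ∈ tile D b) :
    ‖v‖ ≤ al D := by
  obtain ⟨ha, hb, -, hc⟩ := al_bounds hD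
  obtain ⟨h1, h2⟩ := hv
  rw [norm_prod_le_iff, Real.norm_eq_abs, Real.norm_eq_abs, abs_le, abs_le]
  cases b <;> simp only [tileS, tileU, if_true, if_false, mem_Ioo, Bool.false_eq_true] at h1 h2 <;>
    refine ⟨⟨?_, ?_⟩, ⟨?_, ?_⟩⟩ <;> linarith

/-- Trichotomy for integers, in the form of inequalities between reals. -/
theorem int_cast_trichotomy (n : ℤ) : (n : ℝ) ≤ -1 ∨ n = 0 ∨ (1 : ℝ) ≤ n := by
  rcases lt_trichotomy n 0 with h | h | h
  · left; exact_mod_cast (by omega : n ≤ -1)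
  · exact Or.inr (Or.inl h)
  · right; right; exact_mod_cast (by omega : 1 ≤ n)

/-- Distinct translates of the two rectangles are disjoint. -/
theorem tile_packing {D : ℕ} (hD : 1 < D) (hsq : Squarefree D) {b b' : Bool} {v v' : ℝ × ℝ}
    (hv : v ∈ tile D b) (hv' : v' ∈ tile D b') (h : v - v' ∈ lattice D) : b = b' ∧ v = v' := by
  obtain ⟨ha, hb, -, -⟩ := al_bounds hD
  -- By symmetry only the pairs with b' ≤ b need checking (`false ≤ true`). In each, a nonzero
  -- translation (m, n) moves one coordinate out of range.
  have key : ∀ {b b' : Bool} {v v' : ℝ × ℝ}, v ∈ tile D b → v' ∈ tile D b' → b' ≤ b →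
      ∀ m n : ℤ, v - v' = (m + n * alBar D, m + n * al D) → b = b' ∧ v = v' := by
    intro b b' v v' hv hv' hbb m n h
    obtain ⟨h1, h2⟩ := hv
    obtain ⟨h1', h2'⟩ := hv'
    have e1 : v.1 - v'.1 = m + n * alBar D := congrArg Prod.fst h
    have e2 : v.2 - v'.2 = m + n * al D := congrArg Prod.snd h
    suffices hs : m = 0 ∧ n = 0 ∧ b = b' by
      refine ⟨hs.2.2, sub_eq_zero.mp ?_⟩
      rw [h, hs.1, hs.2.1]
      simp
    cases b <;> cases b' <;>
      simp only [tileS, tileU, if_true, if_false, mem_Ioo, Bool.false_eq_true] at h1 h2 h1' h2'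
    · rcases int_cast_trichotomy n with hn | hn | hn
      · exfalso; nlinarith
      · subst hn
        rcases int_cast_trichotomy m with hm | hm | hm
        · exfalso; push_cast at *; linarith
        · exact ⟨hm, rfl, rfl⟩
        · exfalso; push_cast at *; linarith
      · exfalso; nlinarith
    · exact absurd hbb (by decide)
    · exfalso
      rcases int_cast_trichotomy n with hn | hn | hn
      · rcases int_cast_trichotomy m with hm | hm | hm
        · nlinarith
        · subst hm; push_cast at *; nlinarith
        · nlinarith
      · subst hn
        rcases int_cast_trichotomy m with hm | hm | hm
        · push_cast at *; linarith
        · subst hm; push_cast at *; linarith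
        · push_cast at *; linarith
      · rcases int_cast_trichotomy m with hm | hm | hm
        · nlinarith
        · subst hm; push_cast at *; nlinarith
        · nlinarith
    · rcases int_cast_trichotomy n with hn | hn | hn
      · exfalso
        rcases int_cast_trichotomy m with hm | hm | hm
        · nlinarith
        · subst hm; push_cast at *; nlinarith
        · nlinarith
      · subst hn
        rcases int_cast_trichotomy m with hm | hm | hm
        · exfalso; push_cast at *; linarith
        · exact ⟨hm, rfl, rfl⟩
        · exfalso; push_cast at *; linarith
      · exfalso
        rcases int_cast_trichotomy m with hm | hm | hm
        · nlinarith
        · subst hm; push_cast at *; nlinarith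
        · nlinarith
  obtain ⟨m, n, h⟩ := (mem_lattice hsq).mp h
  rcases le_total b' b with hbb | hbb
  · exact key hv hv' hbb m n h
  · have := key hv' hv hbb (-m) (-n) (by
      rw [← neg_sub, h]
      ext
      · simp
        ring
      · simp
        ring)
    exact ⟨this.1.symm, this.2.symm⟩

/-- The unstable boundary segment does not meet the open rectangles. -/
theorem unstable_boundary_disjoint {D : ℕ} (hD : 1 < D) (hsq : Squarefree D) {b : Bool}
    {v : ℝ × ℝ} (hv : v ∈ tile D b) {y : ℝ} (hy : y ∈ Icc 0 (1 + al D))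
    (h : v - (0, y) ∈ lattice D) : False := by
  obtain ⟨ha, hb, -, -⟩ := al_bounds hD
  obtain ⟨m, n, h⟩ := (mem_lattice hsq).mp h
  obtain ⟨h1, h2⟩ := hv
  obtain ⟨hy0, hy1⟩ := hy
  have e1 : v.1 - 0 = m + n * alBar D := congrArg Prod.fst h
  have e2 : v.2 - y = m + n * al D := congrArg Prod.snd h
  cases b <;>
    simp only [tileS, tileU, if_true, if_false, mem_Ioo, Bool.false_eq_true] at h1 h2 <;>
    rcases int_cast_trichotomy n with hn | hn | hn <;>
    rcases int_cast_trichotomy m with hm | hm | hm <;>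
    (try subst hm) <;> (try subst hn) <;> push_cast at * <;> nlinarith

/-- The stable boundary segment does not meet the open rectangles. -/
theorem stable_boundary_disjoint {D : ℕ} (hD : 1 < D) (hsq : Squarefree D) {b : Bool}
    {v : ℝ × ℝ} (hv : v ∈ tile D b) {x : ℝ} (hx : x ∈ Icc (-1) (-alBar D))
    (h : v - (x, 0) ∈ lattice D) : False := by
  obtain ⟨ha, hb, -, -⟩ := al_bounds hD
  obtain ⟨m, n, h⟩ := (mem_lattice hsq).mp h
  obtain ⟨h1, h2⟩ := hv
  obtain ⟨hx0, hx1⟩ := hx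
  have e1 : v.1 - x = m + n * alBar D := congrArg Prod.fst h
  have e2 : v.2 - 0 = m + n * al D := congrArg Prod.snd h
  cases b <;>
    simp only [tileS, tileU, if_true, if_false, mem_Ioo, Bool.false_eq_true] at h1 h2 <;>
    rcases int_cast_trichotomy n with hn | hn | hn <;>
    rcases int_cast_trichotomy m with hm | hm | hm <;>
    (try subst hm) <;> (try subst hn) <;> push_cast at * <;> nlinarith

/-! ### Multiplication by the unit -/

/-- The conjugate of a unit as a real number. -/
def unitS (D : ℕ) (ε : (O D)ˣ) : ℝ := realEmb D (star ((ε : O D) : K D))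

/-- A unit as a real number. -/
def unitU (D : ℕ) (ε : (O D)ˣ) : ℝ := realEmb D ((ε : O D) : K D)

theorem phiV_apply (D : ℕ) (ε : (O D)ˣ) (v : ℝ × ℝ) :
    phiV D ε v = (unitS D ε * v.1, unitU D ε * v.2) := rfl

theorem phiV_mem_lattice {D : ℕ} (ε : (O D)ˣ) {v : ℝ × ℝ} (h : v ∈ lattice D) :
    phiV D ε v ∈ lattice D := by
  obtain ⟨q, rfl⟩ := exists_embed_eq h
  rw [phiV_embed]
  exact embed_mem_lattice ((ε : O D) * q)

theorem phiV_mul (D : ℕ) (ε ε' : (O D)ˣ) (v : ℝ × ℝ) :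
    phiV D (ε * ε') v = phiV D ε (phiV D ε' v) := by
  show (unitV D (ε * ε') : ℝ × ℝ) * v = unitV D ε * (unitV D ε' * v)
  rw [unitV, map_mul, Units.val_mul, mul_assoc]
  rfl

theorem phiV_one (D : ℕ) (v : ℝ × ℝ) : phiV D 1 v = v := by
  show (unitV D 1 : ℝ × ℝ) * v = v
  rw [unitV, map_one, Units.val_one, one_mul]

theorem phiV_inv_phiV (D : ℕ) (ε : (O D)ˣ) (v : ℝ × ℝ) : phiV D ε⁻¹ (phiV D ε v) = v := by
  rw [← phiV_mul, inv_mul_cancel, phiV_one]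

theorem mem_lattice_of_phiV {D : ℕ} (ε : (O D)ˣ) {v : ℝ × ℝ} (h : phiV D ε v ∈ lattice D) :
    v ∈ lattice D := by
  rw [← phiV_inv_phiV D ε v]
  exact phiV_mem_lattice _ h

theorem abs_unit_mul (D : ℕ) (ε : (O D)ˣ) : |unitS D ε * unitU D ε| = 1 := by
  have hint : ∀ u : O D, ∃ m : ℤ, (m : ℚ) = QuadraticAlgebra.norm (u : K D) := fun u => by
    refine exists_int_of_isIntegral_algebraMap (D := D) ?_
    rw [QuadraticAlgebra.algebraMap_norm_eq_mul_star]
    have hu : IsIntegral ℤ (u : K D) := u.2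
    exact hu.mul (isIntegral_star hu)
  have h : |unitS D ε * unitU D ε| = |((QuadraticAlgebra.norm ((ε : O D) : K D) : ℚ) : ℝ)| :=
    absNorm_embed D _
  obtain ⟨m, hm⟩ := hint ε
  obtain ⟨m', hm'⟩ := hint (ε⁻¹ : (O D)ˣ)
  have hmm : m * m' = 1 := by
    have : (m : ℚ) * m' = 1 := by
      have h1 : ((ε : O D) : K D) * (((ε⁻¹ : (O D)ˣ) : O D) : K D) = 1 := by
        exact_mod_cast congrArg Subtype.val (Units.mul_inv ε)
      rw [hm, hm', ← map_mul, h1, map_one]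
    exact_mod_cast this
  rw [h, ← hm]
  have : |m| = 1 := Int.isUnit_iff_abs_eq.mp (IsUnit.of_mul_eq_one _ hmm)
  exact_mod_cast this

/-- Write ε = m + nα. Since ε > ε̄, the coefficient n is at least 1; since ε̄ > -1 and ᾱ < 0, the
coefficient m cannot be negative. -/
theorem al_le_unitU {D : ℕ} (hD : 1 < D) (hsq : Squarefree D) {ε : (O D)ˣ}
    (hε : 1 < unitU D ε) (hneg : unitS D ε < 0) : al D ≤ unitU D ε := by
  obtain ⟨ha, hb, hab, -⟩ := al_bounds hD
  have h1 := abs_unit_mul D ε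
  obtain ⟨m, n, h⟩ := (mem_lattice hsq).mp (embed_mem_lattice (ε : O D))
  have e1 : unitS D ε = m + n * alBar D := congrArg Prod.fst h
  have e2 : unitU D ε = m + n * al D := congrArg Prod.snd h
  rw [abs_of_neg (by nlinarith)] at h1
  have h2 : -1 < unitS D ε := by nlinarith
  have hn : (1 : ℝ) ≤ n := by
    rcases int_cast_trichotomy n with hn | hn | hn
    · nlinarith
    · subst hn; push_cast at *; linarith
    · exact hn
  have hm : (0 : ℝ) ≤ m := by
    rcases int_cast_trichotomy m with hm | hm | hm
    · nlinarith
    · subst hm; simp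
    · linarith
  nlinarith

/-- As |ε̄| < 1, only ε̄ < 0, which swaps the two ends, is delicate. There ε ≥ α gives |ε̄| ≤ 1/α ≤
-ᾱ and |ε̄|(-ᾱ) ≤ 1. -/
theorem stable_boundary_mapsTo {D : ℕ} (hD : 1 < D) (hsq : Squarefree D) {ε : (O D)ˣ}
    (hε : 1 < unitU D ε) {x : ℝ} (hx : x ∈ Icc (-1) (-alBar D)) :
    unitS D ε * x ∈ Icc (-1) (-alBar D) := by
  obtain ⟨ha, hb, hab, hc⟩ := al_bounds hD
  have h1 := abs_unit_mul D ε
  obtain ⟨hx0, hx1⟩ := hx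
  rcases lt_or_ge (unitS D ε) 0 with hneg | hpos
  · have h2 := al_le_unitU hD hsq hε hneg
    rw [abs_of_neg (by nlinarith)] at h1
    have h3 : -unitS D ε ≤ -alBar D := by
      by_contra! h
      nlinarith
    have h4 : -unitS D ε * -alBar D ≤ 1 := by nlinarith
    constructor <;> nlinarith
  · rw [abs_of_nonneg (by nlinarith)] at h1
    have h3 : unitS D ε ≤ 1 := by nlinarith
    constructor <;> nlinarith

/-! ### The projection to the torus and the action of units -/

theorem proj_eq_proj_iff {D : ℕ} {v w : ℝ × ℝ} : proj D v = proj D w ↔ w - v ∈ lattice D := by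
  rw [sub_eq_neg_add]
  exact QuotientAddGroup.eq

theorem phi_proj (D : ℕ) (ε : (O D)ˣ) (v : ℝ × ℝ) : phi D ε (proj D v) = proj D (phiV D ε v) :=
  rfl

theorem proj_surjective (D : ℕ) : Function.Surjective (proj D) := QuotientAddGroup.mk_surjective

theorem continuous_proj (D : ℕ) : Continuous (proj D) := QuotientAddGroup.continuous_mk

theorem phi_mul (D : ℕ) (ε ε' : (O D)ˣ) : phi D (ε * ε') = phi D ε * phi D ε' := by
  ext P
  obtain ⟨v, rfl⟩ := proj_surjective D P
  rw [Equiv.Perm.mul_apply, phi_proj, phi_proj, phi_proj, phiV_mul]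

theorem phi_zpow (D : ℕ) (ε : (O D)ˣ) (k : ℤ) : phi D ε ^ k = phi D (ε ^ k) :=
  (map_zpow (MonoidHom.mk' (phi D) (phi_mul D)) ε k).symm

theorem continuous_phiV (D : ℕ) (ε : (O D)ˣ) : Continuous (phiV D ε) :=
  continuous_const.mul continuous_id

theorem continuous_phi (D : ℕ) (ε : (O D)ˣ) : Continuous (phi D ε) :=
  QuotientAddGroup.isOpenQuotientMap_mk.isQuotientMap.continuous_iff.mpr
    ((continuous_proj D).comp (continuous_phiV D ε))

/-! ### The Markov property -/

theorem exists_mem_uIcc_eq_endpoint {f : ℝ → ℝ} (hf : Continuous f) {a b p q : ℝ}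
    (ha : f a ∈ Ioo p q) (hb : f b ∉ Ioo p q) : ∃ x ∈ uIcc a b, f x = p ∨ f x = q := by
  have hI := intermediate_value_uIcc (a := a) (b := b) hf.continuousOn
  rcases le_or_gt (f b) p with h | h
  · obtain ⟨x, hx, hxp⟩ := hI (mem_uIcc.mpr (Or.inr ⟨h, ha.1.le⟩))
    exact ⟨x, hx, Or.inl hxp⟩
  · have h' : q ≤ f b := by
      by_contra! h'
      exact hb ⟨h, h'⟩
    obtain ⟨x, hx, hxq⟩ := hI (mem_uIcc.mpr (Or.inl ⟨ha.2.le, h'⟩))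
    exact ⟨x, hx, Or.inr hxq⟩

/-- The part of the rectangle `b` whose image under `φ` lies in the translate by `q` of the
rectangle `b'`. -/
def piece (D : ℕ) (ε : (O D)ˣ) (b b' : Bool) (q : ℝ × ℝ) : Set (ℝ × ℝ) :=
  {v ∈ tile D b | phiV D ε v - q ∈ tile D b'}

/-- All unstable sides of the rectangles are lattice translates of parts of {0} × [0, 1 + α]. If the
image of a stable segment left the target rectangle, it would cross such a side. Division by ε maps
{0} × [0, 1 + α] into itself, so a point of the open rectangle `b` would lie on it modulo the
lattice, contrary to `unstable_boundary_disjoint`. -/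
theorem markov_stable {D : ℕ} (hD : 1 < D) (hsq : Squarefree D) {ε : (O D)ˣ}
    (hε : 1 < unitU D ε) {b b' : Bool} {q : ℝ × ℝ} (hq : q ∈ lattice D)
    (h : (piece D ε b b' q).Nonempty) {s : ℝ} (hs : s ∈ tileS D b) :
    unitS D ε * s - q.1 ∈ tileS D b' := by
  obtain ⟨ha, hb, -, -⟩ := al_bounds hD
  obtain ⟨v, hv, hw⟩ := h
  have hwS : unitS D ε * v.1 - q.1 ∈ tileS D b' := hw.1
  have hwU : unitU D ε * v.2 - q.2 ∈ tileU D b' := hw.2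
  set y := unitU D ε * v.2 - q.2 with hy
  by_contra hcon
  have key : ∀ x ∈ uIcc v.1 s, ∀ r ∈ lattice D, ∀ z ∈ Icc 0 (1 + al D),
      (unitS D ε * x - q.1, y) - (0, z) = r → False := by
    intro x hx r hr z hz hxr
    have hxS : x ∈ tileS D b := (ordConnected_tileS D b).uIcc_subset hv.1 hs hx
    refine unstable_boundary_disjoint hD hsq (b := b) (v := (x, v.2)) ⟨hxS, hv.2⟩
      (y := z / unitU D ε) ?_ ?_
    · have h0 : 0 < unitU D ε := by linarith
      exact ⟨div_nonneg hz.1 h0.le, (div_le_self hz.1 hε.le).trans hz.2⟩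
    · refine mem_lattice_of_phiV ε ?_
      have : phiV D ε ((x, v.2) - (0, z / unitU D ε)) = r + q := by
        rw [← hxr, phiV_apply, hy]
        have h0 : unitU D ε ≠ 0 := by linarith
        ext
        · simp
        · simp
          field_simp
          ring
      rw [this]
      exact add_mem hr hq
  have hcont : Continuous fun x : ℝ => unitS D ε * x - q.1 := by fun_prop
  cases b'
  · simp only [tileS, tileU, if_false, Bool.false_eq_true] at hwS hwU hcon
    obtain ⟨x, hx, h0 | h0⟩ := exists_mem_uIcc_eq_endpoint hcont hwS hcon
    · refine key x hx 0 (zero_mem _) y ⟨hwU.1.le, by linarith [hwU.2]⟩ ?_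
      simp [h0]
    · refine key x hx _ (neg_mem (al_mem_lattice D)) (y + al D)
        ⟨by linarith [hwU.1], by linarith [hwU.2]⟩ ?_
      simp [h0]
  · simp only [tileS, tileU, if_true] at hwS hwU hcon
    obtain ⟨x, hx, h0 | h0⟩ := exists_mem_uIcc_eq_endpoint hcont hwS hcon
    · refine key x hx _ (neg_mem (one_mem_lattice D)) (y + 1)
        ⟨by linarith [hwU.1], by linarith [hwU.2]⟩ ?_
      simp [h0]
    · refine key x hx 0 (zero_mem _) y ⟨hwU.1.le, by linarith [hwU.2]⟩ ?_
      simp [h0]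

/-- The mirror argument for φ⁻¹: stable sides are translates of parts of [-1, -ᾱ] × {0}, which φ
maps into itself by `stable_boundary_mapsTo`. -/
theorem markov_unstable {D : ℕ} (hD : 1 < D) (hsq : Squarefree D) {ε : (O D)ˣ}
    (hε : 1 < unitU D ε) {b b' : Bool} {q : ℝ × ℝ} (hq : q ∈ lattice D)
    (h : (piece D ε b b' q).Nonempty) {u : ℝ} (hu : u ∈ tileU D b') :
    (u + q.2) / unitU D ε ∈ tileU D b := by
  obtain ⟨ha, hb, -, -⟩ := al_bounds hD
  obtain ⟨v, hv, hw⟩ := h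
  have h0 : unitU D ε ≠ 0 := by linarith
  have hvU : (unitU D ε * v.2 - q.2 + q.2) / unitU D ε ∈ tileU D b := by
    rw [sub_add_cancel, mul_div_cancel_left₀ _ h0]
    exact hv.2
  have hvS : v.1 ∈ tileS D b := hv.1
  by_contra hcon
  have key : ∀ y ∈ uIcc (unitU D ε * v.2 - q.2) u, ∀ r ∈ lattice D, ∀ x ∈ Icc (-1) (-alBar D),
      (v.1, (y + q.2) / unitU D ε) - (x, 0) = r → False := by
    intro y hy r hr x hx hxr
    have hyU : y ∈ tileU D b' := (ordConnected_tileU D b').uIcc_subset hw.2 hu hy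
    refine stable_boundary_disjoint hD hsq (b := b') (v := (unitS D ε * v.1 - q.1, y))
      ⟨hw.1, hyU⟩ (stable_boundary_mapsTo hD hsq hε hx) ?_
    have : (unitS D ε * v.1 - q.1, y) - (unitS D ε * x, 0) = phiV D ε r - q := by
      rw [← hxr, phiV_apply]
      ext
      · simp
        ring
      · simp
        field_simp
        ring
    rw [this]
    exact sub_mem (phiV_mem_lattice ε hr) hq
  have hcont : Continuous fun y : ℝ => (y + q.2) / unitU D ε := by fun_prop
  have hIcc : v.1 ∈ Icc (-1) (-alBar D) := by
    cases b <;> simp only [tileS, if_true, if_false, Bool.false_eq_true, mem_Ioo] at hvS <;>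
      constructor <;> linarith
  cases b
  · simp only [tileS, tileU, if_false, Bool.false_eq_true] at hvS hvU hcon
    obtain ⟨y, hy, h1 | h1⟩ := exists_mem_uIcc_eq_endpoint hcont hvU hcon
    · exact key y hy 0 (zero_mem _) v.1 hIcc (by simp [h1])
    · refine key y hy _ (one_mem_lattice D) (v.1 - 1)
        ⟨by linarith [hvS.1], by linarith [hvS.2]⟩ (by simp [h1])
  · simp only [tileS, tileU, if_true] at hvS hvU hcon
    obtain ⟨y, hy, h1 | h1⟩ := exists_mem_uIcc_eq_endpoint hcont hvU hcon
    · exact key y hy 0 (zero_mem _) v.1 hIcc (by simp [h1])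
    · refine key y hy _ (al_mem_lattice D) (v.1 - alBar D)
        ⟨by linarith [hvS.1], by linarith [hvS.2]⟩ (by simp [h1])

/-- Any starting point works, because the stable coordinate never leaves its side when iterated
forward. -/
theorem exists_stable_orbit {D : ℕ} (hD : 1 < D) (hsq : Squarefree D) {ε : (O D)ˣ}
    (hε : 1 < unitU D ε) {b : ℕ → Bool} {q : ℕ → ℝ × ℝ} (hq : ∀ k, q k ∈ lattice D)
    (h : ∀ k, (piece D ε (b k) (b (k + 1)) (q k)).Nonempty) :
    ∃ σ : ℕ → ℝ, ∀ k, σ k ∈ tileS D (b k) ∧ σ (k + 1) = unitS D ε * σ k - (q k).1 := by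
  obtain ⟨s₀, hs₀⟩ := tileS_nonempty hD (b 0)
  let σ : ℕ → ℝ := fun k => Nat.rec s₀ (fun j s => unitS D ε * s - (q j).1) k
  refine ⟨σ, fun k => ⟨?_, rfl⟩⟩
  induction k with
  | zero => exact hs₀
  | succ k ih => exact markov_stable hD hsq hε (hq k) (h k) ih

/-- The unstable coordinate is controlled only backward, so the final value is prescribed and pulled
back; hence the finite horizon N. -/
theorem exists_unstable_orbit {D : ℕ} (hD : 1 < D) (hsq : Squarefree D) {ε : (O D)ˣ}
    (hε : 1 < unitU D ε) {b : ℕ → Bool} {q : ℕ → ℝ × ℝ} (hq : ∀ k, q k ∈ lattice D)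
    (h : ∀ k, (piece D ε (b k) (b (k + 1)) (q k)).Nonempty) (N : ℕ) :
    ∃ τ : ℕ → ℝ, (∀ k ≤ N, τ k ∈ tileU D (b k)) ∧
      ∀ k < N, τ (k + 1) = unitU D ε * τ k - (q k).2 := by
  suffices H : ∀ u ∈ tileU D (b N), ∃ τ : ℕ → ℝ, τ N = u ∧ (∀ k ≤ N, τ k ∈ tileU D (b k)) ∧
      ∀ k < N, τ (k + 1) = unitU D ε * τ k - (q k).2 by
    obtain ⟨u, hu⟩ := tileU_nonempty hD (b N)
    obtain ⟨τ, -, hτ⟩ := H u hu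
    exact ⟨τ, hτ⟩
  have h0 : unitU D ε ≠ 0 := by linarith
  induction N with
  | zero =>
    intro u hu
    refine ⟨fun _ => u, rfl, fun k hk => ?_, fun k hk => absurd hk (Nat.not_lt_zero k)⟩
    rwa [Nat.le_zero.mp hk]
  | succ N ih =>
    intro u hu
    obtain ⟨τ, hN, hmem, hrec⟩ := ih _ (markov_unstable hD hsq hε (hq N) (h N) hu)
    refine ⟨Function.update τ (N + 1) u, by simp, fun k hk => ?_, fun k hk => ?_⟩
    · rcases hk.lt_or_eq with hk | rfl
      · rw [Function.update_of_ne hk.ne]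
        exact hmem k (Nat.lt_succ_iff.mp hk)
      · simpa using hu
    · rw [Function.update_of_ne hk.ne]
      rcases (Nat.lt_succ_iff.mp hk).lt_or_eq with hk | rfl
      · rw [Function.update_of_ne (by omega), hrec k hk]
      · rw [Function.update_self, hN]
        field_simp
        ring

/-- Rectangles are products and φ is diagonal, so stable and unstable orbits can be chosen
independently and paired. -/
theorem exists_orbit {D : ℕ} (hD : 1 < D) (hsq : Squarefree D) {ε : (O D)ˣ}
    (hε : 1 < unitU D ε) {b : ℕ → Bool} {q : ℕ → ℝ × ℝ} (hq : ∀ k, q k ∈ lattice D)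
    (h : ∀ k, (piece D ε (b k) (b (k + 1)) (q k)).Nonempty) (N : ℕ) :
    ∃ v : ℕ → ℝ × ℝ, ∀ k < N, v k ∈ piece D ε (b k) (b (k + 1)) (q k) ∧
      v (k + 1) = phiV D ε (v k) - q k := by
  obtain ⟨σ, hσ⟩ := exists_stable_orbit hD hsq hε hq h
  obtain ⟨τ, hτ, hτ'⟩ := exists_unstable_orbit hD hsq hε hq h N
  have hrec : ∀ k < N, (σ (k + 1), τ (k + 1)) = phiV D ε (σ k, τ k) - q k := fun k hk => by
    rw [(hσ k).2, hτ' k hk]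
    rfl
  refine ⟨fun k => (σ k, τ k), fun k hk => ⟨⟨⟨(hσ k).1, hτ k hk.le⟩, ?_⟩, hrec k hk⟩⟩
  rw [← hrec k hk]
  exact ⟨(hσ (k + 1)).1, hτ (k + 1) hk⟩

/-! ### Discreteness of the lattice -/

theorem finite_lattice_norm_le {D : ℕ} (hD : 1 < D) (hsq : Squarefree D) (C : ℝ) :
    {v | v ∈ lattice D ∧ ‖v‖ ≤ C}.Finite := by
  obtain ⟨ha, hb, -, -⟩ := al_bounds hD
  -- The two coordinates differ by n(α - ᾱ), and α - ᾱ > 1, so |n| ≤ 2C; then |m| ≤ C + 2Cα.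
  let N : ℤ := ⌈C + 2 * C * al D⌉
  refine (((finite_Icc (-N) N).prod (finite_Icc (-N) N)).image
    fun p : ℤ × ℤ => ((p.1 + p.2 * alBar D, p.1 + p.2 * al D) : ℝ × ℝ)).subset ?_
  rintro v ⟨hv, hC⟩
  obtain ⟨m, n, rfl⟩ := (mem_lattice hsq).mp hv
  rw [norm_prod_le_iff, Real.norm_eq_abs, Real.norm_eq_abs, abs_le, abs_le] at hC
  obtain ⟨⟨h1, h2⟩, h3, h4⟩ := hC
  simp only at h1 h2 h3 h4
  have hC0 : 0 ≤ C := by linarith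
  have hN : C + 2 * C * al D ≤ N := Int.le_ceil _
  have hn1 : (n : ℝ) ≤ 2 * C := by
    by_contra! h
    nlinarith
  have hn2 : -(2 * C) ≤ (n : ℝ) := by
    by_contra! h
    nlinarith
  have hn1' : (n : ℝ) * al D ≤ 2 * C * al D := by gcongr
  have hn2' : -(2 * C) * al D ≤ n * al D := by gcongr
  have hCa : C * 1 ≤ C * al D := by gcongr
  refine ⟨(m, n), ⟨⟨?_, ?_⟩, ⟨?_, ?_⟩⟩, rfl⟩
  · have : -(N : ℝ) ≤ m := by linarith
    exact_mod_cast this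
  · have : (m : ℝ) ≤ N := by linarith
    exact_mod_cast this
  · have : -(N : ℝ) ≤ n := by linarith
    exact_mod_cast this
  · have : (n : ℝ) ≤ N := by linarith
    exact_mod_cast this

theorem embed_injective {D : ℕ} (hD : 1 < D) (hsq : Squarefree D) :
    Function.Injective fun q : O D => embed D q := by
  obtain ⟨ha, hb, -, -⟩ := al_bounds hD
  rintro ⟨x, hx⟩ ⟨y, hy⟩ h
  have h' : embed D (x - y) = 0 := by rw [map_sub]; exact sub_eq_zero.mpr h
  obtain ⟨m, n, hmn⟩ := exists_int_of_mem_O hsq ((O D).sub_mem hx hy)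
  rw [hmn, embed_int_combo, Prod.mk_eq_zero] at h'
  have hn : (n : ℝ) * (al D - alBar D) = 0 := by linarith [h'.1, h'.2]
  have hn0 : (n : ℝ) = 0 := (mul_eq_zero.mp hn).resolve_right (by linarith)
  have hm0 : (m : ℝ) = 0 := by simpa [hn0] using h'.1
  have : x - y = 0 := by
    rw [hmn, Int.cast_eq_zero.mp hn0, Int.cast_eq_zero.mp hm0]
    simp
  exact Subtype.ext (sub_eq_zero.mp this)

/-- Packing gives discreteness: 0 is the only lattice vector that moves a given point of R₀ to a
point of R₀, and this is an open condition. -/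
theorem isClosed_lattice {D : ℕ} (hD : 1 < D) (hsq : Squarefree D) :
    IsClosed (lattice D : Set (ℝ × ℝ)) := by
  have : DiscreteTopology (lattice D) := by
    refine discreteTopology_of_isOpen_singleton_zero ?_
    obtain ⟨s, hs⟩ := tileS_nonempty hD false
    obtain ⟨u, hu⟩ := tileU_nonempty hD false
    have hv : (s, u) ∈ tile D false := ⟨hs, hu⟩
    have : ({0} : Set (lattice D)) =
        (fun r : lattice D => (r : ℝ × ℝ) + (s, u)) ⁻¹' tile D false := by
      ext r
      constructor
      · rintro rfl
        simpa using hv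
      · intro hr
        have := (tile_packing hD hsq hr hv (by simp)).2
        exact Subtype.ext (by simpa using this)
    rw [this]
    exact (isOpen_tile D false).preimage (by fun_prop)
  exact AddSubgroup.isClosed_of_discrete

theorem t2Space_torus {D : ℕ} (hD : 1 < D) (hsq : Squarefree D) : T2Space (Torus D) := by
  have := isClosed_lattice hD hsq
  infer_instance

/-! ### The letters -/

theorem convex_piece (D : ℕ) (ε : (O D)ˣ) (b b' : Bool) (q : ℝ × ℝ) :
    Convex ℝ (piece D ε b b' q) := by
  intro x hx y hy r s hr hs hrs
  refine ⟨convex_tile D b hx.1 hy.1 hr hs hrs, ?_⟩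
  have : phiV D ε (r • x + s • y) - q = r • (phiV D ε x - q) + s • (phiV D ε y - q) := by
    have hs' : s = 1 - r := by linarith
    subst hs'
    simp only [phiV_apply]
    ext
    · simp
      ring
    · simp
      ring
  rw [this]
  exact convex_tile D b' hx.2 hy.2 hr hs hrs

theorem isOpen_piece (D : ℕ) (ε : (O D)ˣ) (b b' : Bool) (q : ℝ × ℝ) :
    IsOpen (piece D ε b b' q) :=
  (isOpen_tile D b).inter
    ((isOpen_tile D b').preimage ((continuous_phiV D ε).sub continuous_const))

theorem mem_overlap_tile_iff {D : ℕ} {ε : (O D)ˣ} {b b' : Bool} {v : ℝ × ℝ} :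
    v ∈ overlap D ε (tile D b) (tile D b') ↔ ∃ q ∈ lattice D, v ∈ piece D ε b b' q := by
  constructor
  · rintro ⟨hv, w, hw, h⟩
    rw [phi_proj, proj_eq_proj_iff] at h
    exact ⟨_, h, hv, by rwa [sub_sub_cancel]⟩
  · rintro ⟨q, hq, hv, hw⟩
    refine ⟨hv, _, hw, ?_⟩
    rwa [phi_proj, proj_eq_proj_iff, sub_sub_cancel]

/-- The overlap is the union of the pieces over all lattice vectors. These are open, convex, and
disjoint by `tile_packing`, so they are its components. -/
theorem connectedComponentIn_overlap {D : ℕ} (hD : 1 < D) (hsq : Squarefree D) {ε : (O D)ˣ}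
    {b b' : Bool} {q v : ℝ × ℝ} (hq : q ∈ lattice D) (hv : v ∈ piece D ε b b' q) :
    connectedComponentIn (overlap D ε (tile D b) (tile D b')) v = piece D ε b b' q := by
  have hvo : v ∈ overlap D ε (tile D b) (tile D b') := mem_overlap_tile_iff.mpr ⟨q, hq, hv⟩
  apply Subset.antisymm
  · refine isPreconnected_connectedComponentIn.subset_left_of_subset_union
      (isOpen_piece D ε b b' q)
      (isOpen_iUnion fun r => isOpen_iUnion fun _ => isOpen_piece D ε b b' r :
        IsOpen (⋃ r, ⋃ _ : r ∈ lattice D ∧ r ≠ q, piece D ε b b' r)) ?_ ?_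
      ⟨v, mem_connectedComponentIn hvo, hv⟩
    · rw [disjoint_left]
      intro w hw hw'
      simp only [mem_iUnion] at hw'
      obtain ⟨r, ⟨hr, hrq⟩, hw'⟩ := hw'
      refine hrq ?_
      have := (tile_packing hD hsq hw.2 hw'.2
        (by rw [sub_sub_sub_cancel_left]; exact sub_mem hr hq)).2
      exact (sub_right_inj.mp this).symm
    · intro w hw
      obtain ⟨r, hr, hw'⟩ := mem_overlap_tile_iff.mp (connectedComponentIn_subset _ _ hw)
      by_cases h : r = q
      · subst h
        exact Or.inl hw'
      · refine Or.inr ?_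
        simp only [mem_iUnion]
        exact ⟨r, ⟨hr, h⟩, hw'⟩
  · exact (convex_piece D ε b b' q).isPreconnected.subset_connectedComponentIn hv
      fun w hw => mem_overlap_tile_iff.mpr ⟨q, hq, hw⟩

theorem exists_eq_piece {D : ℕ} (hD : 1 < D) (hsq : Squarefree D) {ε : (O D)ˣ} (h5 : D ≠ 5)
    {C : Set (ℝ × ℝ)} (hC : C ∈ P0 D ε) :
    ∃ b b' : Bool, ∃ q ∈ lattice D, (piece D ε b b' q).Nonempty ∧ C = piece D ε b b' q := by
  rw [P0, if_neg h5] at hC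
  obtain ⟨A, hA, B, hB, v, hv, rfl⟩ := hC
  obtain ⟨b, rfl⟩ := mem_tiles_iff.mp hA
  obtain ⟨b', rfl⟩ := mem_tiles_iff.mp hB
  obtain ⟨q, hq, hv'⟩ := mem_overlap_tile_iff.mp hv
  exact ⟨b, b', q, hq, ⟨v, hv'⟩, connectedComponentIn_overlap hD hsq hq hv'⟩

theorem exists_eq_tile {D : ℕ} {ε : (O D)ˣ} (h5 : D = 5) {C : Set (ℝ × ℝ)} (hC : C ∈ P0 D ε) :
    ∃ b : Bool, C = tile D b := by
  rw [P0, if_pos h5] at hC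
  exact mem_tiles_iff.mp hC

theorem exists_subset_tile {D : ℕ} (hD : 1 < D) (hsq : Squarefree D) {ε : (O D)ˣ}
    {C : Set (ℝ × ℝ)} (hC : C ∈ P0 D ε) : ∃ b : Bool, C ⊆ tile D b := by
  by_cases h5 : D = 5
  · obtain ⟨b, rfl⟩ := exists_eq_tile h5 hC
    exact ⟨b, Subset.rfl⟩
  · obtain ⟨b, b', q, -, -, rfl⟩ := exists_eq_piece hD hsq h5 hC
    exact ⟨b, fun v hv => hv.1⟩

theorem abs_unitS_le_one {D : ℕ} {ε : (O D)ˣ} (hε : 1 < unitU D ε) : |unitS D ε| ≤ 1 := by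
  have h := abs_unit_mul D ε
  rw [abs_mul, abs_of_pos (by linarith : 0 < unitU D ε)] at h
  nlinarith [abs_nonneg (unitS D ε)]

theorem norm_phiV_le {D : ℕ} {ε : (O D)ˣ} (hε : 1 < unitU D ε) (v : ℝ × ℝ) :
    ‖phiV D ε v‖ ≤ unitU D ε * ‖v‖ := by
  rw [phiV_apply, norm_prod_le_iff]
  simp only [norm_mul, Real.norm_eq_abs]
  rw [abs_of_pos (by linarith : 0 < unitU D ε)]
  constructor
  · exact mul_le_mul ((abs_unitS_le_one hε).trans hε.le) (norm_fst_le v) (abs_nonneg _) (by linarith)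
  · exact mul_le_mul_of_nonneg_left (norm_snd_le v) (by linarith)

/-- A piece is given by two rectangles and a translation q; if it is nonempty, q is a difference of
bounded vectors, and the lattice is discrete. -/
theorem finite_P0 {D : ℕ} (hD : 1 < D) (hsq : Squarefree D) {ε : (O D)ˣ}
    (hε : 1 < unitU D ε) : (P0 D ε).Finite := by
  by_cases h5 : D = 5
  · rw [P0, if_pos h5]
    exact toFinite _
  · refine ((finite_univ.prod (finite_univ.prod
      (finite_lattice_norm_le hD hsq (unitU D ε * al D + al D)))).image
      fun p : Bool × Bool × (ℝ × ℝ) => piece D ε p.1 p.2.1 p.2.2).subset ?_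
    intro C hC
    obtain ⟨b, b', q, hq, ⟨v, hv⟩, rfl⟩ := exists_eq_piece hD hsq h5 hC
    refine ⟨(b, b', q), ⟨mem_univ _, mem_univ _, hq, ?_⟩, rfl⟩
    have h1 : q = phiV D ε v - (phiV D ε v - q) := by abel
    rw [h1]
    refine (norm_sub_le _ _).trans (add_le_add ((norm_phiV_le hε v).trans ?_)
      (norm_le_of_mem_tile hD hv.2))
    exact mul_le_mul_of_nonneg_left (norm_le_of_mem_tile hD hv.1) (by linarith)

/-! ### The golden mean case -/

theorem isUnit_alphaK_five : IsUnit (⟨alphaK 5, alphaK_mem 5⟩ : O 5) := by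
  refine IsUnit.of_mul_eq_one (⟨alphaK 5, alphaK_mem 5⟩ - 1) (Subtype.ext ?_)
  show alphaK 5 * (alphaK 5 - 1) = 1
  rw [alphaK, if_pos (by norm_num)]
  ext
  · simp [QuadraticAlgebra.re_one, QuadraticAlgebra.im_one]
    norm_num
  · simp [QuadraticAlgebra.re_one, QuadraticAlgebra.im_one]
    norm_num

theorem unitU_zpow (D : ℕ) (ε : (O D)ˣ) (k : ℤ) : unitU D (ε ^ k) = unitU D ε ^ k := by
  let f : (O D)ˣ →* ℝˣ := Units.map ((realEmb D).toRingHom.comp (O D).toSubring.subtype).toMonoidHom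
  have h : ∀ u, unitU D u = (f u : ℝ) := fun u => rfl
  rw [h, h, map_zpow, Units.val_zpow_eq_zpow_val]

theorem unitS_zpow (D : ℕ) (ε : (O D)ˣ) (k : ℤ) : unitS D (ε ^ k) = unitS D ε ^ k := by
  let f : (O D)ˣ →* ℝˣ := Units.map (((RingHom.fst ℝ ℝ).comp (embed D)).comp
    (O D).toSubring.subtype).toMonoidHom
  have h : ∀ u, unitS D u = (f u : ℝ) := fun u => rfl
  rw [h, h, map_zpow, Units.val_zpow_eq_zpow_val]

/-- The golden ratio α is a unit, so α = εᵏ with k ≥ 1 and ε ≤ α. As ᾱ = ε̄ᵏ is negative, so is ε̄,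
and `al_le_unitU` gives α ≤ ε. -/
theorem unitU_five {ε : (O 5)ˣ} (hε : IsFundamentalUnit 5 ε) :
    unitU 5 ε = al 5 ∧ unitS 5 ε = alBar 5 := by
  obtain ⟨ha, hb, -, -⟩ := al_bounds (by norm_num : 1 < 5)
  obtain ⟨-, -, h5⟩ := al_five
  have h1 : 1 < unitU 5 ε := hε.1
  obtain ⟨u, hu⟩ := isUnit_alphaK_five
  have huU : unitU 5 u = al 5 := by
    rw [unitU, hu]
    rfl
  have huS : unitS 5 u = alBar 5 := by
    rw [unitS, hu]
    rfl
  have hneg : ∀ w : (O 5)ˣ, unitU 5 (-w) = -unitU 5 w := fun w => map_neg (realEmb 5) _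
  obtain ⟨k, rfl | rfl⟩ := hε.2 u
  · rw [unitU_zpow] at huU
    rw [unitS_zpow] at huS
    have hk : 1 ≤ k := by
      by_contra! hk
      have := zpow_le_one_of_nonpos₀ h1.le (by omega : k ≤ 0)
      linarith
    have hS : unitS 5 ε < 0 := by
      by_contra! h
      have := zpow_nonneg h k
      linarith
    have hle : unitU 5 ε ≤ al 5 := by
      rw [← huU]
      simpa using zpow_le_zpow_right₀ h1.le hk
    have heq : unitU 5 ε = al 5 :=
      le_antisymm hle (al_le_unitU (by norm_num) (by decide +kernel) h1 hS)
    refine ⟨heq, ?_⟩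
    have habs := abs_unit_mul 5 ε
    rw [heq, abs_of_neg (by nlinarith)] at habs
    have : al 5 * unitS 5 ε = al 5 * alBar 5 := by linarith
    exact mul_left_cancel₀ (by linarith) this
  · rw [hneg, unitU_zpow] at huU
    have := zpow_pos (by linarith : 0 < unitU 5 ε) k
    linarith

/-- This is why R₀ and R₁ suffice as letters for D = 5: φ maps R₀ into R₁, and maps R₁ across R₀ and
R₁ + (1, 1), so a transition determines its translation. -/
theorem eq_of_mem_piece_five {ε : (O 5)ˣ} (hε : IsFundamentalUnit 5 ε) {b b' : Bool}
    {q v : ℝ × ℝ} (hq : q ∈ lattice 5) (hv : v ∈ piece 5 ε b b' q) :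
    q = if b && b' then (1, 1) else 0 := by
  obtain ⟨ha, hb, -, -⟩ := al_bounds (by norm_num : 1 < 5)
  obtain ⟨h5, h5', -⟩ := al_five
  have hsq : Squarefree 5 := by decide +kernel
  obtain ⟨hU, hS⟩ := unitU_five hε
  obtain ⟨hv, hw⟩ := hv
  obtain ⟨hv1, hv2⟩ := hv
  have hphi : phiV 5 ε v = (alBar 5 * v.1, al 5 * v.2) := by rw [phiV_apply, hU, hS]
  have key : ∀ c : Bool, ∀ r ∈ lattice 5, phiV 5 ε v - r ∈ tile 5 c → c = b' ∧ q = r := by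
    intro c r hr h
    obtain ⟨h1, h2⟩ := tile_packing (by norm_num) hsq h hw
      (by rw [sub_sub_sub_cancel_left]; exact sub_mem hq hr)
    exact ⟨h1, (sub_right_inj.mp h2).symm⟩
  cases b <;> simp only [tileS, tileU, if_true, if_false, mem_Ioo, Bool.false_eq_true] at hv1 hv2
  · refine (key true 0 (zero_mem _) ?_).2
    rw [sub_zero, hphi]
    refine ⟨⟨?_, ?_⟩, ⟨?_, ?_⟩⟩ <;> nlinarith
  · rcases lt_trichotomy (al 5 * v.2) 1 with h | h | h
    · obtain ⟨rfl, h0⟩ := key false 0 (zero_mem _) (by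
        rw [sub_zero, hphi]
        refine ⟨⟨?_, ?_⟩, ⟨?_, ?_⟩⟩ <;> nlinarith)
      simpa using h0
    -- This height is sent to the top side of R₀, which translation by -(1, 1) places on the stable
    -- boundary segment.
    · exfalso
      refine stable_boundary_disjoint (by norm_num) hsq hw (x := alBar 5 * v.1 - 1)
        ⟨by nlinarith, by nlinarith⟩ ?_
      have : phiV 5 ε v - q - (alBar 5 * v.1 - 1, 0) = (1, 1) - q := by
        rw [hphi, h]
        ext
        · simp
        · simp
      rw [this]
      exact sub_mem (one_mem_lattice 5) hq
    · obtain ⟨rfl, h0⟩ := key true (1, 1) (one_mem_lattice 5) (by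
        rw [hphi]
        refine ⟨⟨?_, ?_⟩, ⟨?_, ?_⟩⟩ <;> simp only [Prod.fst_sub, Prod.snd_sub] <;> nlinarith)
      simpa using h0

/-! ### Itineraries -/

/-- Two consecutive letters determine the translation by which planar lifts are related. -/
theorem sub_eq_phiV_sub {D : ℕ} (hD : 1 < D) (hsq : Squarefree D) {ε : (O D)ˣ}
    (hε : IsFundamentalUnit D ε) {A B : Set (ℝ × ℝ)} (hA : A ∈ P0 D ε) (hB : B ∈ P0 D ε)
    {x y x' y' : ℝ × ℝ} (hx : x ∈ A) (hy : y ∈ A) (hx' : x' ∈ B) (hy' : y' ∈ B)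
    (hxx : phi D ε (proj D x) = proj D x') (hyy : phi D ε (proj D y) = proj D y') :
    x' - y' = phiV D ε (x - y) := by
  rw [phi_proj] at hxx hyy
  by_cases h5 : D = 5
  · obtain ⟨b, rfl⟩ := exists_eq_tile h5 hA
    obtain ⟨b', rfl⟩ := exists_eq_tile h5 hB
    subst h5
    have h1 := eq_of_mem_piece_five hε (b := b) (b' := b') (v := x)
      (proj_eq_proj_iff.mp hxx.symm) ⟨hx, by rwa [sub_sub_cancel]⟩
    have h2 := eq_of_mem_piece_five hε (b := b) (b' := b') (v := y)
      (proj_eq_proj_iff.mp hyy.symm) ⟨hy, by rwa [sub_sub_cancel]⟩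
    rw [map_sub, ← sub_sub_cancel (phiV 5 ε x) x', h1, ← h2]
    abel
  · obtain ⟨b, b', q, hq, -, rfl⟩ := exists_eq_piece hD hsq h5 hA
    obtain ⟨c, hc⟩ := exists_subset_tile hD hsq hB
    have key : ∀ {z z' : ℝ × ℝ}, z ∈ piece D ε b b' q → z' ∈ B →
        proj D (phiV D ε z) = proj D z' → z' = phiV D ε z - q := by
      intro z z' hz hz' h
      refine (tile_packing hD hsq (hc hz') hz.2 ?_).2
      have : z' - (phiV D ε z - q) = (z' - phiV D ε z) + q := by abel
      rw [this]
      exact add_mem (proj_eq_proj_iff.mp h) hq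
    rw [key hx hx' hxx, key hy hy' hyy, map_sub]
    abel

/-- This puts both kinds of alphabet in the form needed by `exists_orbit`. For D ≠ 5 each letter
carries its own target rectangle and translation, and admissibility matches that target with the
source of the next letter; for D = 5 the translation is read off the transition. -/
theorem exists_itinerary {D : ℕ} (hD : 1 < D) (hsq : Squarefree D) {ε : (O D)ˣ}
    {s : ℤ → Letter D ε} (hs : s ∈ Sig D ε) :
    ∃ (b : ℤ → Bool) (q : ℤ → ℝ × ℝ), ∀ i, q i ∈ lattice D ∧
      (piece D ε (b i) (b (i + 1)) (q i)).Nonempty ∧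
        piece D ε (b i) (b (i + 1)) (q i) ⊆ s i := by
  by_cases h5 : D = 5
  · choose b hb using fun i => exists_eq_tile h5 (s i).2
    have : ∀ i, ∃ q ∈ lattice D, (piece D ε (b i) (b (i + 1)) q).Nonempty := by
      intro i
      obtain ⟨_, ⟨v, hv, rfl⟩, w, hw, h⟩ := hs i
      rw [phi_proj, proj_eq_proj_iff] at h
      rw [hb i] at hv
      rw [hb (i + 1)] at hw
      exact ⟨_, h, v, hv, by rwa [sub_sub_cancel]⟩
    choose q hq hne using this
    refine ⟨b, q, fun i => ⟨hq i, hne i, ?_⟩⟩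
    rw [hb i]
    exact fun v hv => hv.1
  · choose b c q hq hne hpiece using fun i => exists_eq_piece hD hsq h5 (s i).2
    have hbc : ∀ i, c i = b (i + 1) := by
      intro i
      obtain ⟨_, ⟨v, hv, rfl⟩, w, hw, h⟩ := hs i
      rw [phi_proj, proj_eq_proj_iff] at h
      rw [hpiece i] at hv
      rw [hpiece (i + 1)] at hw
      refine (tile_packing hD hsq hv.2 hw.1 ?_).1
      rw [sub_right_comm]
      exact sub_mem h (hq i)
    refine ⟨b, q, fun i => ⟨hq i, ?_, ?_⟩⟩
    · rw [← hbc]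
      exact hne i
    · rw [← hbc, hpiece i]

/-! ### Cells along a string -/

/-- The word of `s` on the window `[-n, n]`. -/
def word {D : ℕ} {ε : (O D)ˣ} (s : ℤ → Letter D ε) (n : ℕ) : Word D ε n := fun i => s i

/-- The string `s` translated by `k`. -/
def shift {α : Type*} (k : ℤ) (s : ℤ → α) : ℤ → α := fun i => s (k + i)

theorem shift_mem_Sig {D : ℕ} {ε : (O D)ˣ} {s : ℤ → Letter D ε} (hs : s ∈ Sig D ε) (k : ℤ) :
    shift k s ∈ Sig D ε := by
  intro i
  have := hs (k + i)
  rwa [add_assoc] at this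

/-- By the Markov property, transitions that are admissible one at a time are realised by a common
orbit over the whole window. -/
theorem cell_nonempty {D : ℕ} (hD : 1 < D) (hsq : Squarefree D) {ε : (O D)ˣ}
    (hε : IsFundamentalUnit D ε) {s : ℤ → Letter D ε} (hs : s ∈ Sig D ε) (n : ℕ) :
    (cell D ε n (word s n)).Nonempty := by
  obtain ⟨b, q, h⟩ := exists_itinerary hD hsq hs
  have hidx : ∀ k : ℕ, -(n : ℤ) + (k + 1 : ℕ) = -(n : ℤ) + k + 1 := fun k => by push_cast; ring
  obtain ⟨v, hv⟩ := exists_orbit hD hsq hε.1 (b := fun k => b (-(n : ℤ) + k))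
    (q := fun k => q (-(n : ℤ) + k)) (fun k => (h _).1)
    (fun k => by simp only [hidx]; exact (h _).2.1) (2 * n + 1)
  have hmem : ∀ k < 2 * n + 1, v k ∈ (s (-(n : ℤ) + k) : Set (ℝ × ℝ)) := fun k hk => by
    refine (h _).2.2 ?_
    have := (hv k hk).1
    simpa only [hidx] using this
  have hproj : ∀ k ≤ 2 * n + 1, proj D (v k) = (phi D ε ^ k) (proj D (v 0)) := by
    intro k
    induction k with
    | zero => intro _; rfl
    | succ k ih =>
      intro hk
      rw [pow_succ', Equiv.Perm.mul_apply, ← ih (by omega), phi_proj, proj_eq_proj_iff,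
        (hv k (by omega)).2, sub_sub_cancel]
      exact (h _).1
  -- The orbit starts at time -n, so its n-th term is the point at time 0.
  refine ⟨v n, ?_, ?_⟩
  · have := hmem n (by omega)
    rwa [neg_add_cancel] at this
  · rintro ⟨i, hi1, hi2⟩
    obtain ⟨k, rfl⟩ : ∃ k : ℕ, i = -(n : ℤ) + k := ⟨(i + n).toNat, by omega⟩
    refine ⟨v k, hmem k (by omega), ?_⟩
    rw [hproj k (by omega), hproj n (by omega), ← zpow_natCast, ← zpow_natCast,
      ← Equiv.Perm.mul_apply, ← zpow_add]
    congr 2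
    ring

theorem norm_le_of_mem_letter {D : ℕ} (hD : 1 < D) (hsq : Squarefree D) {ε : (O D)ˣ}
    (A : Letter D ε) {v : ℝ × ℝ} (hv : v ∈ (A : Set (ℝ × ℝ))) : ‖v‖ ≤ al D := by
  obtain ⟨b, hb⟩ := exists_subset_tile hD hsq A.2
  exact norm_le_of_mem_tile hD (hb hv)

/-- Along a common word the difference of two lifts evolves linearly, by `sub_eq_phiV_sub`, and
stays bounded by 2α. Its stable part at time 0 has been contracted since time -n; its unstable part
must still expand until time n. -/
theorem dist_le_of_mem_cell {D : ℕ} (hD : 1 < D) (hsq : Squarefree D) {ε : (O D)ˣ}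
    (hε : IsFundamentalUnit D ε) {n : ℕ} {w : Word D ε n} {x y : ℝ × ℝ}
    (hx : x ∈ cell D ε n w) (hy : y ∈ cell D ε n w) :
    dist x y ≤ 2 * al D * (unitU D ε)⁻¹ ^ n := by
  have hU : 1 < unitU D ε := hε.1
  have hlift : ∀ {z : ℝ × ℝ}, z ∈ cell D ε n w → ∃ Z : ℤ → ℝ × ℝ, Z 0 = z ∧
      ∀ i (hi : i ∈ Icc (-(n : ℤ)) n), Z i ∈ (w ⟨i, hi⟩ : Set (ℝ × ℝ)) ∧
        (phi D ε ^ i) (proj D z) = proj D (Z i) := by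
    intro z hz
    -- The lift at time 0 must be z itself; outside the window z serves as a default.
    have : ∀ i : ℤ, ∃ Z : ℝ × ℝ, (i = 0 → Z = z) ∧
        ∀ hi : i ∈ Icc (-(n : ℤ)) n, Z ∈ (w ⟨i, hi⟩ : Set (ℝ × ℝ)) ∧
          (phi D ε ^ i) (proj D z) = proj D Z := by
      intro i
      by_cases h0 : i = 0
      · subst h0
        exact ⟨z, fun _ => rfl, fun _ => ⟨hz.1, rfl⟩⟩
      · by_cases hi : i ∈ Icc (-(n : ℤ)) n
        · obtain ⟨Z, hZ, hZ'⟩ := hz.2 ⟨i, hi⟩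
          exact ⟨Z, fun h => absurd h h0, fun _ => ⟨hZ, hZ'.symm⟩⟩
        · exact ⟨z, fun h => absurd h h0, fun h => absurd h hi⟩
    choose Z hZ0 hZ using this
    exact ⟨Z, hZ0 0 rfl, hZ⟩
  obtain ⟨X, rfl, hX⟩ := hlift hx
  obtain ⟨Y, rfl, hY⟩ := hlift hy
  have hstep : ∀ i, -(n : ℤ) ≤ i → i < n → X (i + 1) - Y (i + 1) = phiV D ε (X i - Y i) := by
    intro i h1 h2
    have hi : i ∈ Icc (-(n : ℤ)) n := ⟨h1, h2.le⟩
    have hi' : i + 1 ∈ Icc (-(n : ℤ)) n := ⟨by omega, by omega⟩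
    refine sub_eq_phiV_sub hD hsq hε (w ⟨i, hi⟩).2 (w ⟨i + 1, hi'⟩).2 (hX i hi).1 (hY i hi).1
      (hX _ hi').1 (hY _ hi').1 ?_ ?_
    · rw [← (hX i hi).2, ← (hX _ hi').2, ← Equiv.Perm.mul_apply, add_comm, zpow_add, zpow_one]
    · rw [← (hY i hi).2, ← (hY _ hi').2, ← Equiv.Perm.mul_apply, add_comm, zpow_add, zpow_one]
  have hiter : ∀ (i : ℤ) (k : ℕ), -(n : ℤ) ≤ i → i + k ≤ n →
      X (i + k) - Y (i + k) =
        (unitS D ε ^ k * (X i - Y i).1, unitU D ε ^ k * (X i - Y i).2) := by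
    intro i k h1
    induction k with
    | zero =>
      intro _
      simp
      rfl
    | succ k ih =>
      intro h2
      push_cast at h2 ⊢
      rw [← add_assoc, hstep _ (by omega) (by omega), ih (by omega), phiV_apply]
      ext
      · simp only
        ring
      · simp only
        ring
  have hbound : ∀ i ∈ Icc (-(n : ℤ)) n, ‖X i - Y i‖ ≤ 2 * al D := by
    intro i hi
    refine (norm_sub_le _ _).trans ?_
    linarith [norm_le_of_mem_letter hD hsq _ (hX i hi).1, norm_le_of_mem_letter hD hsq _ (hY i hi).1]
  have habs : |unitS D ε| = (unitU D ε)⁻¹ := by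
    have := abs_unit_mul D ε
    rw [abs_mul, abs_of_pos (by linarith : 0 < unitU D ε)] at this
    exact eq_inv_of_mul_eq_one_left this
  have hUn : 0 < unitU D ε ^ n := pow_pos (by linarith) n
  rw [dist_eq_norm, norm_prod_le_iff]
  constructor
  · have h := hiter (-(n : ℤ)) n le_rfl (by omega)
    rw [neg_add_cancel] at h
    rw [h, Real.norm_eq_abs, abs_mul, abs_pow, habs, mul_comm]
    refine mul_le_mul_of_nonneg_right ?_ (by positivity)
    exact (norm_fst_le _).trans (hbound _ ⟨le_rfl, by omega⟩)
  · have h := hiter 0 n (by omega) (by omega)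
    rw [zero_add] at h
    have h2 := (norm_snd_le _).trans (hbound n ⟨by omega, le_rfl⟩)
    rw [h, norm_mul, Real.norm_of_nonneg hUn.le] at h2
    rw [inv_pow, ← div_eq_mul_inv, le_div_iff₀ hUn, mul_comm]
    exact h2

theorem dist_le_of_mem_closure_cell {D : ℕ} (hD : 1 < D) (hsq : Squarefree D) {ε : (O D)ˣ}
    (hε : IsFundamentalUnit D ε) {n : ℕ} {w : Word D ε n} {x y : ℝ × ℝ}
    (hx : x ∈ closure (cell D ε n w)) (hy : y ∈ closure (cell D ε n w)) :
    dist x y ≤ 2 * al D * (unitU D ε)⁻¹ ^ n := by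
  have hcl : IsClosed {p : (ℝ × ℝ) × (ℝ × ℝ) | dist p.1 p.2 ≤ 2 * al D * (unitU D ε)⁻¹ ^ n} :=
    isClosed_le (by fun_prop) continuous_const
  have hsub : cell D ε n w ×ˢ cell D ε n w ⊆
      {p : (ℝ × ℝ) × (ℝ × ℝ) | dist p.1 p.2 ≤ 2 * al D * (unitU D ε)⁻¹ ^ n} :=
    fun p hp => dist_le_of_mem_cell hD hsq hε hp.1 hp.2
  have := closure_minimal hsub hcl
  rw [closure_prod_eq] at this
  exact this (mk_mem_prod hx hy)

theorem norm_le_of_mem_closure_cell {D : ℕ} (hD : 1 < D) (hsq : Squarefree D) {ε : (O D)ˣ}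
    {n : ℕ} {w : Word D ε n} {x : ℝ × ℝ} (hx : x ∈ closure (cell D ε n w)) : ‖x‖ ≤ al D :=
  closure_minimal (fun _ hv => norm_le_of_mem_letter hD hsq _ hv.1)
    (isClosed_le continuous_norm continuous_const) hx

theorem isCompact_closure_cell {D : ℕ} (hD : 1 < D) (hsq : Squarefree D) {ε : (O D)ˣ}
    {n : ℕ} (w : Word D ε n) : IsCompact (closure (cell D ε n w)) := by
  refine (isCompact_closedBall (0 : ℝ × ℝ) (al D)).of_isClosed_subset isClosed_closure ?_
  intro x hx
  rw [mem_closedBall_zero_iff]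
  exact norm_le_of_mem_closure_cell hD hsq hx

theorem cell_word_antitone {D : ℕ} {ε : (O D)ˣ} (s : ℤ → Letter D ε) (n : ℕ) :
    cell D ε (n + 1) (word s (n + 1)) ⊆ cell D ε n (word s n) := by
  rintro v ⟨h0, h⟩
  refine ⟨h0, fun i => h ⟨i, ?_⟩⟩
  obtain ⟨h1, h2⟩ := i.2
  constructor
  · push_cast
    omega
  · push_cast
    omega

theorem iInter_eq_proj_image_cell {D : ℕ} {ε : (O D)ˣ} (s : ℤ → Letter D ε) (n : ℕ) :
    ⋂ i ∈ Icc (-(n : ℤ)) n, {P | (phi D ε ^ i) P ∈ tset D ε (s i)} =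
      proj D '' cell D ε n (word s n) := by
  ext P
  simp only [mem_iInter, mem_ofPred_eq]
  constructor
  · intro h
    obtain ⟨v, hv, hvP⟩ := h 0 ⟨by omega, by omega⟩
    have hvP' : proj D v = P := hvP
    exact ⟨v, ⟨hv, fun i => by rw [hvP']; exact h i i.2⟩, hvP'⟩
  · rintro ⟨v, ⟨-, hv⟩, rfl⟩ i hi
    exact hv ⟨i, hi⟩

/-! ### The coding map -/

/-- The closed planar cells are nested nonempty compacta with diameters tending to 0. -/
theorem exists_codingSet_eq {D : ℕ} (hD : 1 < D) (hsq : Squarefree D) {ε : (O D)ˣ}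
    (hε : IsFundamentalUnit D ε) {s : ℤ → Letter D ε} (hs : s ∈ Sig D ε) :
    ∃ x, codingSet D ε s = {proj D x} ∧ ∀ n, x ∈ closure (cell D ε n (word s n)) := by
  have := t2Space_torus hD hsq
  have hU : 1 < unitU D ε := hε.1
  obtain ⟨x, hx⟩ := IsCompact.nonempty_iInter_of_sequence_nonempty_isCompact_isClosed
    (fun n => closure (cell D ε n (word s n))) (fun n => closure_mono (cell_word_antitone s n))
    (fun n => (cell_nonempty hD hsq hε hs n).closure) (isCompact_closure_cell hD hsq _)
    (fun n => isClosed_closure)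
  rw [mem_iInter] at hx
  refine ⟨x, ?_, hx⟩
  -- Closure commutes with projection because closed cells are compact and the torus is Hausdorff.
  have hcl : ∀ n : ℕ, closure (⋂ i ∈ Icc (-(n : ℤ)) n, {P | (phi D ε ^ i) P ∈ tset D ε (s i)}) =
      proj D '' closure (cell D ε n (word s n)) := fun n => by
    rw [iInter_eq_proj_image_cell]
    exact ((isCompact_closure_cell hD hsq _).image (continuous_proj D)).isClosed.closure_subset_iff.mpr
      (image_mono subset_closure) |>.antisymm (image_closure_subset_closure_image (continuous_proj D))
  refine Subset.antisymm (fun P hP => ?_) ?_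
  · rw [codingSet, mem_iInter] at hP
    simp only [hcl] at hP
    choose y hy hyP using hP
    have hlim : Filter.Tendsto y Filter.atTop (𝓝 x) := by
      rw [tendsto_iff_dist_tendsto_zero]
      refine squeeze_zero (fun n => dist_nonneg)
        (fun n => dist_le_of_mem_closure_cell hD hsq hε (hy n) (hx n)) ?_
      rw [← mul_zero (2 * al D)]
      exact (tendsto_pow_atTop_nhds_zero_of_lt_one (by positivity)
        (inv_lt_one_of_one_lt₀ hU)).const_mul _
    have h1 := ((continuous_proj D).tendsto x).comp hlim
    have h2 : (proj D ∘ y) = fun _ => P := funext hyP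
    rw [h2] at h1
    exact tendsto_nhds_unique tendsto_const_nhds h1
  · rintro _ rfl
    rw [codingSet, mem_iInter]
    intro n
    rw [hcl]
    exact mem_image_of_mem _ (hx n)

theorem codingSet_eq_piMap {D : ℕ} (hD : 1 < D) (hsq : Squarefree D) {ε : (O D)ˣ}
    (hε : IsFundamentalUnit D ε) {s : ℤ → Letter D ε} (hs : s ∈ Sig D ε) :
    codingSet D ε s = {piMap D ε s} := by
  obtain ⟨x, hx, -⟩ := exists_codingSet_eq hD hsq hε hs
  exact Classical.epsilon_spec (p := fun P => codingSet D ε s = {P}) ⟨_, hx⟩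

theorem exists_lift_piMap {D : ℕ} (hD : 1 < D) (hsq : Squarefree D) {ε : (O D)ˣ}
    (hε : IsFundamentalUnit D ε) {s : ℤ → Letter D ε} (hs : s ∈ Sig D ε) :
    ∃ x, piMap D ε s = proj D x ∧ ∀ n, x ∈ closure (cell D ε n (word s n)) := by
  obtain ⟨x, hx, hx'⟩ := exists_codingSet_eq hD hsq hε hs
  rw [codingSet_eq_piMap hD hsq hε hs] at hx
  exact ⟨x, singleton_injective hx, hx'⟩

theorem piMap_shift {D : ℕ} (hD : 1 < D) (hsq : Squarefree D) {ε : (O D)ˣ}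
    (hε : IsFundamentalUnit D ε) {s : ℤ → Letter D ε} (hs : s ∈ Sig D ε) (k : ℤ) :
    piMap D ε (shift k s) = phi D (ε ^ k) (piMap D ε s) := by
  have hP : piMap D ε s ∈ codingSet D ε s := by
    rw [codingSet_eq_piMap hD hsq hε hs]
    rfl
  have h : phi D (ε ^ k) (piMap D ε s) ∈ codingSet D ε (shift k s) := by
    rw [codingSet, mem_iInter] at hP ⊢
    intro n
    -- The window of radius n around k lies in the window of radius n + |k| around 0.
    refine map_mem_closure (continuous_phi D (ε ^ k)) (hP (n + k.natAbs)) ?_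
    intro Q hQ
    simp only [mem_iInter, mem_ofPred_eq] at hQ ⊢
    intro i hi
    rw [← phi_zpow, ← Equiv.Perm.mul_apply, ← zpow_add, add_comm]
    refine hQ (k + i) ?_
    obtain ⟨h1, h2⟩ := hi
    constructor <;> omega
  rw [codingSet_eq_piMap hD hsq hε (shift_mem_Sig hs k)] at h
  exact h.symm

/-! ### The Euclidean minimum -/

theorem euclMin_proj_lt_iff {D : ℕ} {v : ℝ × ℝ} {t : ℝ} :
    euclMin D (proj D v) < t ↔ ∃ q ∈ lattice D, absNorm (v - q) < t := by
  have h : euclMin D (proj D v) = ⨅ q : lattice D, absNorm (v - q) := rfl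
  rw [h, ciInf_lt_iff ⟨0, by rintro _ ⟨q, rfl⟩; exact abs_nonneg _⟩]
  simp

theorem absNorm_phiV (D : ℕ) (ε : (O D)ˣ) (v : ℝ × ℝ) : absNorm (phiV D ε v) = absNorm v := by
  rw [phiV_apply, absNorm, absNorm, mul_mul_mul_comm, abs_mul, abs_unit_mul, one_mul]

/-- One implication suffices for the invariance of M, since the unit may be replaced by its inverse.
-/
theorem euclMin_phi_lt {D : ℕ} (ε : (O D)ˣ) {P : Torus D} {t : ℝ} (h : euclMin D P < t) :
    euclMin D (phi D ε P) < t := by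
  obtain ⟨v, rfl⟩ := proj_surjective D P
  obtain ⟨q, hq, h⟩ := euclMin_proj_lt_iff.mp h
  rw [phi_proj, euclMin_proj_lt_iff]
  exact ⟨_, phiV_mem_lattice ε hq, by rwa [← map_sub, absNorm_phiV]⟩

theorem absNorm_le_sq (v : ℝ × ℝ) : absNorm v ≤ ‖v‖ ^ 2 := by
  rw [absNorm, abs_mul, pow_two]
  exact mul_le_mul (norm_fst_le v) (norm_snd_le v) (abs_nonneg _) (norm_nonneg _)

theorem absNorm_le_add (x y : ℝ × ℝ) :
    absNorm x ≤ absNorm y + ‖x - y‖ * (2 * ‖y‖ + ‖x - y‖) := by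
  have h1 := norm_fst_le (x - y)
  have h2 := norm_snd_le (x - y)
  have h3 := norm_fst_le y
  have h4 := norm_snd_le y
  rw [Real.norm_eq_abs] at h1 h2 h3 h4
  have e : x.1 * x.2 = y.1 * y.2 + ((x - y).1 * (x - y).2 + (x - y).1 * y.2 + y.1 * (x - y).2) := by
    simp only [Prod.fst_sub, Prod.snd_sub]
    ring
  rw [absNorm, absNorm, e]
  refine (abs_add_le _ _).trans (add_le_add_right ?_ _)
  refine (abs_add_three _ _ _).trans ?_
  rw [abs_mul, abs_mul, abs_mul]
  have a1 : |(x - y).1| * |(x - y).2| ≤ ‖x - y‖ * ‖x - y‖ := by gcongr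
  have a2 : |(x - y).1| * |y.2| ≤ ‖x - y‖ * ‖y‖ := by gcongr
  have a3 : |y.1| * |(x - y).2| ≤ ‖y‖ * ‖x - y‖ := by gcongr
  linarith

/-- Every vector has a bounded multiple by a power of the unit, with a bound that depends only
on the norm. -/
theorem exists_norm_phiV_zpow_le {D : ℕ} {ε : (O D)ˣ} (hε : 1 < unitU D ε) (v : ℝ × ℝ) {t : ℝ}
    (ht : absNorm v ≤ t) : ∃ k : ℤ, ‖phiV D (ε ^ k) v‖ ≤ unitU D ε + t := by
  have ht0 : 0 ≤ t := (abs_nonneg _).trans ht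
  have h0 : 0 < unitU D ε := by linarith
  have habs : |unitS D ε| = (unitU D ε)⁻¹ := by
    have := abs_unit_mul D ε
    rw [abs_mul, abs_of_pos h0] at this
    exact eq_inv_of_mul_eq_one_left this
  have hscale : ∀ {x : ℝ}, x ≠ 0 → ∃ k : ℤ, 1 ≤ unitU D ε ^ k * |x| ∧
      unitU D ε ^ k * |x| ≤ unitU D ε := by
    intro x hx
    obtain ⟨m, hm1, hm2⟩ := exists_mem_Ico_zpow (abs_pos.mpr hx) hε
    have hpos : 0 < unitU D ε ^ m := zpow_pos h0 m
    refine ⟨-m, ?_, ?_⟩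
    · rw [zpow_neg, inv_mul_eq_div, le_div_iff₀ hpos, one_mul]
      exact hm1
    · rw [zpow_neg, inv_mul_eq_div, div_le_iff₀ hpos, mul_comm, ← zpow_add_one₀ h0.ne']
      exact hm2.le
  -- Normally the unstable coordinate is scaled into [1, ε], which leaves at most t for the stable
  -- one. If it vanishes, the stable coordinate is scaled instead.
  by_cases hu : v.2 = 0
  · by_cases hs : v.1 = 0
    · refine ⟨0, ?_⟩
      have : v = 0 := Prod.ext hs hu
      rw [this, map_zero, norm_zero]
      linarith
    · obtain ⟨k, -, hk⟩ := hscale hs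
      refine ⟨-k, ?_⟩
      rw [phiV_apply, norm_prod_le_iff, hu, mul_zero, norm_zero, unitS_zpow, norm_mul, norm_zpow,
        Real.norm_eq_abs, Real.norm_eq_abs, habs, inv_zpow', neg_neg]
      exact ⟨by linarith, by linarith⟩
  · obtain ⟨k, hk1, hk⟩ := hscale hu
    refine ⟨k, ?_⟩
    have hN : absNorm (phiV D (ε ^ k) v) ≤ t := by rwa [absNorm_phiV]
    have h2 : |(phiV D (ε ^ k) v).2| = unitU D ε ^ k * |v.2| := by
      rw [phiV_apply, abs_mul, unitU_zpow, abs_of_pos (zpow_pos h0 k)]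
    rw [absNorm, abs_mul, h2] at hN
    rw [norm_prod_le_iff, Real.norm_eq_abs, Real.norm_eq_abs, h2]
    refine ⟨?_, by linarith⟩
    nlinarith [abs_nonneg (phiV D (ε ^ k) v).1]

/-! ### Subshifts of finite type -/

/-- A set of strings over a finite alphabet that is determined by the words of some fixed length
is a subshift of finite type. -/
theorem isSFT_of_local {α : Type*} [Finite α] {Y : Set (ℤ → α)} (N : ℕ)
    (hY : ∀ s : ℤ → α, (∀ k : ℤ, ∃ s' ∈ Y, ∃ k' : ℤ, ∀ j < N, s (k + (j : ℕ)) = s' (k' + (j : ℕ))) →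
      s ∈ Y) : IsSFT Y := by
  -- The forbidden words are all words of length N that occur in no string of Y.
  refine ⟨inferInstance, {l : List α | l.length = N ∧
    ∀ s ∈ Y, ¬ ∃ k : ℤ, ∀ j : Fin l.length, s (k + (j : ℕ)) = l.get j},
    (List.finite_length_eq α N).subset fun l hl => hl.1, Subset.antisymm ?_ ?_⟩
  · exact fun s hs l hl => hl.2 s hs
  · intro s hs
    refine hY s fun k => ?_
    by_contra! hcon
    refine hs (List.ofFn fun j : Fin N => s (k + (j : ℕ))) ⟨by simp, ?_⟩ ⟨k, fun j => by simp⟩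
    rintro s' hs' ⟨k', hk'⟩
    obtain ⟨j, hj, hne⟩ := hcon s' hs' k'
    refine hne ?_
    have := hk' ⟨j, by simpa using hj⟩
    simpa using this.symm

/-! ### The coding of the sublevel sets -/

theorem piInv_subset_avoid {D : ℕ} (hD : 1 < D) (hsq : Squarefree D) {ε : (O D)ˣ}
    (hε : IsFundamentalUnit D ε) (n : ℕ) (t : ℝ) (I : Finset (O D)) :
    piInv D ε (X D t) ⊆ avoid D ε (Tn D ε n t I) := by
  rintro s ⟨hs, hst⟩
  refine ⟨hs, ?_⟩
  -- The level m need not be n, since `avoid` compares cells as sets; only the inclusion of the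
  -- closure is used.
  rintro m w ⟨-, hw⟩ ⟨k, hk⟩
  obtain rfl : word (shift k s) m = w := funext hk
  obtain ⟨y, hy, hycl⟩ := exists_lift_piMap hD hsq hε (shift_mem_Sig hs k)
  obtain ⟨q, -, hq⟩ := hw (hycl m)
  have h1 : euclMin D (phi D (ε ^ k) (piMap D ε s)) < t := by
    rw [← piMap_shift hD hsq hε hs, hy, euclMin_proj_lt_iff]
    exact ⟨_, embed_mem_lattice q, hq⟩
  have h2 := euclMin_phi_lt (ε ^ k)⁻¹ h1
  rw [← Equiv.Perm.mul_apply, ← phi_mul, inv_mul_cancel] at h2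
  have h3 : phi D (1 : (O D)ˣ) (piMap D ε s) = piMap D ε s := by
    obtain ⟨v, hv⟩ := proj_surjective D (piMap D ε s)
    rw [← hv, phi_proj, phiV_one]
  rw [h3] at h2
  exact absurd hst (not_le.mpr h2)

/-- If the coded point has small Euclidean minimum, then some cell along the string is covered. -/
theorem exists_closure_cell_subset_U {D : ℕ} (hD : 1 < D) (hsq : Squarefree D) {ε : (O D)ˣ}
    (hε : IsFundamentalUnit D ε) {I : Finset (O D)}
    (hI : ∀ q : O D, ‖embed D q‖ ≤ al D + (unitU D ε + (al D ^ 2 + 1)) → q ∈ I) {t η : ℝ} {n : ℕ}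
    (hn1 : 2 * al D * (unitU D ε)⁻¹ ^ n ≤ 1)
    (hn : 2 * al D * (unitU D ε)⁻¹ ^ n * (2 * (unitU D ε + (al D ^ 2 + 1)) + 1) ≤ η)
    {s : ℤ → Letter D ε} (hs : s ∈ Sig D ε) (ht : euclMin D (piMap D ε s) < t - η) :
    ∃ k, closure (cell D ε n (word (shift k s) n)) ⊆ U D t I := by
  obtain ⟨ha, -⟩ := al_bounds hD
  obtain ⟨x, hx, hxcl⟩ := exists_lift_piMap hD hsq hε hs
  have hxn : ‖x‖ ≤ al D := norm_le_of_mem_closure_cell hD hsq (hxcl 0)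
  -- This bound, from the lattice point 0, is what makes the required set of translates independent
  -- of t.
  have hsmall : euclMin D (proj D x) < al D ^ 2 + 1 := by
    rw [euclMin_proj_lt_iff]
    refine ⟨0, zero_mem _, ?_⟩
    rw [sub_zero]
    have : ‖x‖ ^ 2 ≤ al D ^ 2 := by gcongr
    linarith [absNorm_le_sq x]
  rw [hx] at ht
  obtain ⟨q, hq, hxq⟩ := euclMin_proj_lt_iff.mp (lt_min ht hsmall)
  obtain ⟨hxq1, hxq2⟩ := lt_min_iff.mp hxq
  obtain ⟨k, hk⟩ := exists_norm_phiV_zpow_le hε.1 (x - q) hxq2.le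
  obtain ⟨y, hy, hycl⟩ := exists_lift_piMap hD hsq hε (shift_mem_Sig hs k)
  rw [piMap_shift hD hsq hε hs, hx, phi_proj, proj_eq_proj_iff] at hy
  -- The point p is chosen so that y - p is the rescaled vector φᵏ(x - q), which is bounded.
  obtain ⟨p, hp⟩ := exists_embed_eq (add_mem hy (phiV_mem_lattice (ε ^ k) hq))
  have hyp : y - embed D p = phiV D (ε ^ k) (x - q) := by
    rw [hp, map_sub]
    abel
  have hyn : ‖y‖ ≤ al D := norm_le_of_mem_closure_cell hD hsq (hycl n)
  refine ⟨k, fun z hz => ⟨p, hI p ?_, ?_⟩⟩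
  · have : embed D p = y - (y - embed D p) := by abel
    rw [this]
    refine (norm_sub_le _ _).trans (add_le_add hyn ?_)
    rwa [hyp]
  · have hzy : ‖z - y‖ ≤ 2 * al D * (unitU D ε)⁻¹ ^ n := by
      rw [← dist_eq_norm]
      exact dist_le_of_mem_closure_cell hD hsq hε hz (hycl n)
    have h := absNorm_le_add (z - embed D p) (y - embed D p)
    rw [sub_sub_sub_cancel_right] at h
    rw [← hyp] at hk
    have h2 : ‖z - y‖ * (2 * ‖y - embed D p‖ + ‖z - y‖) ≤
        2 * al D * (unitU D ε)⁻¹ ^ n * (2 * (unitU D ε + (al D ^ 2 + 1)) + 1) :=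
      mul_le_mul hzy (by linarith) (by positivity) ((norm_nonneg _).trans hzy)
    have h3 : absNorm (y - embed D p) < t - η := by
      rw [hyp, absNorm_phiV]
      exact hxq1
    linarith

end QuadTorus

end

/-! ### The main theorem -/

open QuadTorus in
theorem proposition3 (D : ℕ) (hD : 1 < D) (hsq : Squarefree D)
    (ε : (O D)ˣ) (hε : IsFundamentalUnit D ε) :
    ∃ I_K : Finset (O D), ∀ I : Finset (O D), I_K ⊆ I →
      ∀ t η : ℝ, 0 < t → 0 < η → X D t = X D (t - η) →
        IsSFT (piInv D ε (X D t)) ∧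
          ∃ n : ℕ, piInv D ε (X D t) = avoid D ε (Tn D ε n t I) := by
  have hU : 1 < unitU D ε := hε.1
  obtain ⟨ha, -⟩ := al_bounds hD
  -- B bounds the rescaled difference and α bounds the lift, so the lattice points of norm at most α
  -- + B are enough for I_K.
  set B : ℝ := unitU D ε + (al D ^ 2 + 1) with hB
  have hfin : {q : O D | ‖embed D q‖ ≤ al D + B}.Finite :=
    ((finite_lattice_norm_le hD hsq (al D + B)).preimage
      (embed_injective hD hsq).injOn).subset fun q hq => ⟨embed_mem_lattice q, hq⟩
  refine ⟨hfin.toFinset, fun I hI t η ht hη hX => ?_⟩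
  have hI' : ∀ q : O D, ‖embed D q‖ ≤ al D + B → q ∈ I :=
    fun q hq => hI (hfin.mem_toFinset.mpr hq)
  have hlim : Filter.Tendsto (fun n : ℕ => 2 * al D * (unitU D ε)⁻¹ ^ n) Filter.atTop (𝓝 0) := by
    rw [← mul_zero (2 * al D)]
    exact (tendsto_pow_atTop_nhds_zero_of_lt_one (by positivity)
      (inv_lt_one_of_one_lt₀ hU)).const_mul _
  have hlim' : Filter.Tendsto (fun n : ℕ => 2 * al D * (unitU D ε)⁻¹ ^ n * (2 * B + 1))
      Filter.atTop (𝓝 0) := by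
    rw [← zero_mul (2 * B + 1)]
    exact hlim.mul_const _
  obtain ⟨n, hn1, hn⟩ := ((hlim.eventually_le_const one_pos).and
    (hlim'.eventually_le_const hη)).exists
  have key : ∀ s ∈ Sig D ε, piMap D ε s ∉ X D t →
      ∃ k, cell D ε n (word (shift k s) n) ∈ Tn D ε n t I := by
    intro s hs hst
    rw [hX] at hst
    obtain ⟨k, hk⟩ := exists_closure_cell_subset_U hD hsq hε hI' hn1 hn hs (not_le.mp hst)
    exact ⟨k, ⟨cell_nonempty hD hsq hε (shift_mem_Sig hs k) n, _, rfl⟩, hk⟩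
  have hsub := piInv_subset_avoid hD hsq hε n t I
  refine ⟨?_, n, hsub.antisymm ?_⟩
  · have : Finite (Letter D ε) := (finite_P0 hD hsq hU).to_subtype
    -- The length covers both a level-n word, of length 2n + 1, and a transition, of length 2, even
    -- when n = 0.
    refine isSFT_of_local (2 * n + 2) fun s hs => ?_
    have hsS : s ∈ Sig D ε := by
      intro i
      obtain ⟨s', hs', k', h⟩ := hs i
      have h0 := h 0 (by omega)
      have h1 := h 1 (by omega)
      simp only [Nat.cast_zero, add_zero, Nat.cast_one] at h0 h1
      rw [h0, h1]
      exact hs'.1 k'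
    refine ⟨hsS, ?_⟩
    by_contra hst
    obtain ⟨k, hk⟩ := key s hsS hst
    -- The window starts at k - n so that the word centred at k lies inside it; in s' that word is
    -- centred at k' + n.
    obtain ⟨s', hs', k', h⟩ := hs (k - n)
    refine (hsub hs').2 n _ hk ⟨k' + n, fun i => ?_⟩
    obtain ⟨i, hi1, hi2⟩ := i
    have h1 := h (i + n).toNat (by omega)
    have e1 : k - (n : ℤ) + ((i + n).toNat : ℤ) = k + i := by omega
    have e2 : k' + ((i + n).toNat : ℤ) = k' + n + i := by omega
    rw [e1, e2] at h1
    exact h1.symm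
  · rintro s ⟨hs, hsa⟩
    refine ⟨hs, ?_⟩
    by_contra hst
    obtain ⟨k, hk⟩ := key s hs hst
    exact hsa n _ hk ⟨k, fun i => rfl⟩
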